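/- **Setting.** Let $M$ be a smooth manifold and let $E\to M$ be a smooth *quaternionic vector bundle*: a real vector bundle with typical fibre $\mathbb{H}^k$ and structural group $\mathrm{Sp}(1)\cdot\mathrm{GL}(k,\mathbb{H})$, acting on $\mathbb{H}^k$ by $q\mapsto aqA^{-1}$. The *admissible linear complex structures* on a fibre of $E$ are the endomorphisms which, in an admissible frame, are given by left multiplication by an imaginary quaternion of length $1$; they form a bundle $\pi:Z\to M$ with fibre $S^2$, where each fibre $Z_x$ carries the complex structure given by $A\mapsto JA$ on $T_JZ_x\subseteq\mathrm{End}(E_x)$. For $J\in Z$ let $E^J=\ker(J+\mathrm{i})\subseteq E^{\mathbb{C}}_{\pi(J)}$. Let $\rho:E\to TM$ be a morphism of vector bundles such that $(E,\rho)$ is an *almost co-CR quaternionic structure*: $\rho$ is surjective and its kernel contains no nonzero subspace preserved by some $J\in Z$. Let $\nabla$ be a smooth connection on $E$ which is *compatible* (with the structural group of $E$), and let $R$ be its curvature form. It is *torsion free* (with respect to $\rho$) if $\rho(\nabla_{\rho\circ s_1}s_2-\nabla_{\rho\circ s_2}s_1)=[\rho\circ s_1,\rho\circ s_2]$ for all local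 sections $s_1,s_2$ of $E$. It *satisfies the first Bianchi identity with respect to $Z$* if it is torsion free and, extending $R$ and $\rho$ complex multilinearly, $$R(\rho(e_1),\rho(e_2))e_3+R(\rho(e_2),\rho(e_3))e_1+R(\rho(e_3),\rho(e_1))e_2=0$$ for all $J\in Z$ and $e_1,e_2,e_3\in E^J$. Let $\mathcal{C}$ be the complex distribution on $Z$ given by $\mathcal{C}=(\ker d\pi)^{0,1}\oplus\mathcal{B}$, where $\mathcal{B}_J$ is the horizontal lift of $\rho(E^J)$ at $J\in Z$, with respect to the connection induced by $\nabla$ on $Z$. One says that $(E,\rho,\nabla)$ is *integrable* if $\mathcal{C}$ is integrable, that is, the Lie bracket of any two local sections of $\mathcal{C}$ is a section of $\mathcal{C}$. **Corollary 2.3.** Let $(M,E,\rho)$ be an almost co-CR quaternionic manifold with $\operatorname{rank}E>4$ (real rank, so $k\geq2$). If $\nabla$ is a compatible connection on $E$ which satisfies the first Bianchi identity with respect to $Z$, then $(E,\rho,\nabla)$ is integrable. -/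

import Mathlib

open Bundle Set Manifold ContDiff Quaternion

noncomputable section

namespace CoCR

/-! ### Complexification

A vector `u + i v` of the complexification of a real vector space is written as the pair `(u, v)`. -/

/-- The kernel of `J + i` on the complexification of a real vector space, for a real linear
operator `J`: the pairs `(u, v)` with `(J + i) (u + i v) = (J u - v) + i (J v + u) = 0`. -/
def kerAddI {W : Type*} [AddCommGroup W] [Module ℝ W] (J : W →ₗ[ℝ] W) : Set (W × W) :=
  {w | J w.1 - w.2 = 0 ∧ J w.2 + w.1 = 0}

/-- The complex bilinear extension of a real bilinear operation `b`:
`b (u + i v, u' + i v') = (b (u, u') - b (v, v')) + i (b (u, v') + b (v, u'))`. -/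
def complexify₂ {A B C : Type*} [Add C] [Sub C] (b : A → B → C) (w : A × A) (w' : B × B) : C × C :=
  (b w.1 w'.1 - b w.2 w'.2, b w.1 w'.2 + b w.2 w'.1)

/-! ### Quaternions and the two-sphere of imaginary units -/

/-- The typical fibre `ℍᵏ`. -/
abbrev QSpace (k : ℕ) : Type := Fin k → ℍ[ℝ]

/-- The two-sphere. -/
abbrev S2 : Type := Metric.sphere (0 : EuclideanSpace ℝ (Fin 3)) 1

/-- The identification of `ℝ³` with the space of imaginary quaternions, which maps `S2` onto the
imaginary quaternions of length `1`. -/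
def imQ (v : EuclideanSpace ℝ (Fin 3)) : ℍ[ℝ] := ⟨0, v 0, v 1, v 2⟩

/-- Left multiplication by a quaternion on `ℍᵏ`, `q ↦ (a q₁, …, a q_k)`. -/
def leftMul (k : ℕ) (a : ℍ[ℝ]) : QSpace k →ₗ[ℝ] QSpace k where
  toFun q := fun i => a * q i
  map_add' q q' := by ext1 i; simp [mul_add]
  map_smul' c q := by ext1 i; simp

section Bundles

variable {EM : Type*} [NormedAddCommGroup EM] [NormedSpace ℝ EM]
  {M : Type*} [TopologicalSpace M] [ChartedSpace EM M]
  [IsManifold 𝓘(ℝ, EM) 1 M] {k : ℕ}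
  {V : M → Type*} [TopologicalSpace (TotalSpace (QSpace k) V)]
  [∀ x, AddCommGroup (V x)] [∀ x, Module ℝ (V x)] [∀ x, TopologicalSpace (V x)]
  [FiberBundle (QSpace k) V] [VectorBundle ℝ (QSpace k) V]

/-! ### Quaternionic vector bundles -/

variable (k V) in
/-- The vector bundle `V`, with typical fibre `ℍᵏ` and with its given atlas of trivializations, is
a quaternionic vector bundle: its structural group is `Sp(1)·GL(k,ℍ)`, that is, the transition
functions are of the form `q ↦ a q A⁻¹`, with `a` a unit quaternion and `A ∈ GL(k,ℍ)`
(the elements of `ℍᵏ` are thought of as row vectors). -/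
def IsQuaternionicVectorBundle : Prop :=
  ∀ (e e' : Trivialization (QSpace k) (π (QSpace k) V))
    [MemTrivializationAtlas e] [MemTrivializationAtlas e'],
    ∀ x ∈ e.baseSet ∩ e'.baseSet, ∃ (a : ℍ[ℝ]) (A : (Matrix (Fin k) (Fin k) ℍ[ℝ])ˣ),
      ‖a‖ = 1 ∧ ∀ q : QSpace k,
        e.coordChangeL ℝ e' x q = Matrix.vecMul (leftMul k a q) (A⁻¹).val

/-- The endomorphism of the fibre of `V` over `x` which corresponds to left multiplication by the
imaginary quaternion `a ∈ S2` under the trivialization `e`. For `e` in the atlas of a quaternionic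
vector bundle, `(x, a) ↦ (x, trivJ e x a)` is the trivialization, over the base set of `e`, of the
bundle of admissible linear complex structures. -/
def trivJ (e : Trivialization (QSpace k) (π (QSpace k) V)) [MemTrivializationAtlas e]
    (x : M) (a : S2) : V x →ₗ[ℝ] V x :=
  e.symmₗ ℝ x ∘ₗ leftMul k (imQ a) ∘ₗ e.linearMapAt ℝ x

variable (k V) in
/-- The fibre over `x` of the bundle `Z` of admissible linear complex structures of `V`. -/
def admissible (x : M) : Set (V x →ₗ[ℝ] V x) :=
  {J | ∃ (e : Trivialization (QSpace k) (π (QSpace k) V)) (_ : MemTrivializationAtlas e),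
    x ∈ e.baseSet ∧ ∃ a : S2, J = trivJ e x a}

/-! ### Almost co-CR quaternionic structures -/

variable (k) in
/-- `(V, ρ)` is an almost co-CR quaternionic structure on `M`: `V` is a quaternionic vector bundle
and `ρ : V → TM` is a surjective (smooth) morphism of vector bundles whose kernel contains no
nonzero subspace preserved by some admissible linear complex structure. -/
structure IsAlmostCoCRQuaternionic (ρ : ∀ x : M, V x →ₗ[ℝ] TangentSpace 𝓘(ℝ, EM) x) : Prop where
  quaternionic : IsQuaternionicVectorBundle k V
  smooth : ContMDiff (𝓘(ℝ, EM).prod 𝓘(ℝ, QSpace k)) (𝓘(ℝ, EM).prod 𝓘(ℝ, EM)) ∞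
    (fun v : TotalSpace (QSpace k) V => (⟨v.1, ρ v.1 v.2⟩ : TangentBundle 𝓘(ℝ, EM) M))
  surjective : ∀ x, Function.Surjective (ρ x)
  kernel : ∀ x, ∀ J ∈ admissible k V x, ∀ W : Submodule ℝ (V x),
    W ≤ LinearMap.ker (ρ x) → (∀ w ∈ W, J w ∈ W) → W = ⊥

/-! ### Connections -/

variable [∀ x, IsTopologicalAddGroup (V x)] [∀ x, ContinuousSMul ℝ (V x)]

/-- The local connection form of `∇` with respect to the trivialization `e`: if `q ∈ ℍᵏ` and `s` is
the section of `V` which `e` maps to the constant `q`, then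
`connForm ∇ e x X q` is the image under `e` of `(∇_X s)(x)`. -/
def connForm (nabla : CovariantDerivative 𝓘(ℝ, EM) (QSpace k) V)
    (e : Trivialization (QSpace k) (π (QSpace k) V)) [MemTrivializationAtlas e]
    (x : M) (X : TangentSpace 𝓘(ℝ, EM) x) (q : QSpace k) : QSpace k :=
  e.linearMapAt ℝ x (nabla (fun y => e.symmₗ ℝ y q) x X)

/-- The connection `∇` is compatible with the structural group `Sp(1)·GL(k,ℍ)`: its local connection
forms take values in the Lie algebra of this group, that is, in the space of maps `q ↦ p q + q B`
with `p` an imaginary quaternion and `B` a quaternionic matrix. -/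
def IsCompatible (nabla : CovariantDerivative 𝓘(ℝ, EM) (QSpace k) V) : Prop :=
  ∀ (e : Trivialization (QSpace k) (π (QSpace k) V)) [MemTrivializationAtlas e],
    ∀ x ∈ e.baseSet, ∀ X : TangentSpace 𝓘(ℝ, EM) x,
      ∃ (p : EuclideanSpace ℝ (Fin 3)) (B : Matrix (Fin k) (Fin k) ℍ[ℝ]), ∀ q : QSpace k,
        connForm nabla e x X q = leftMul k (imQ p) q + Matrix.vecMul q B

variable (EM k) in
/-- `s` is a smooth section of `V` over `U`. -/
def IsSmoothSectionOn (s : ∀ x, V x) (U : Set M) : Prop :=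
  ContMDiffOn 𝓘(ℝ, EM) (𝓘(ℝ, EM).prod 𝓘(ℝ, QSpace k)) ∞ (fun x => TotalSpace.mk' (QSpace k) x (s x)) U

/-- The connection `∇` on `V` is torsion free with respect to `ρ : V → TM`:
`ρ ∘ (∇_{ρ ∘ s₁} s₂ - ∇_{ρ ∘ s₂} s₁) - [ρ ∘ s₁, ρ ∘ s₂] = 0` for all local sections `s₁, s₂`. -/
def IsTorsionFree (nabla : CovariantDerivative 𝓘(ℝ, EM) (QSpace k) V)
    (ρ : ∀ x : M, V x →ₗ[ℝ] TangentSpace 𝓘(ℝ, EM) x) : Prop :=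
  ∀ (U : Set M) (s₁ s₂ : ∀ x, V x), IsOpen U →
    IsSmoothSectionOn EM k s₁ U → IsSmoothSectionOn EM k s₂ U → ∀ x ∈ U,
      ρ x (nabla s₂ x (ρ x (s₁ x)) - nabla s₁ x (ρ x (s₂ x)))
        - VectorField.mlieBracket 𝓘(ℝ, EM) (fun y => ρ y (s₁ y)) (fun y => ρ y (s₂ y)) x = 0

/-- The section `R(X, Y) s = ∇_X ∇_Y s - ∇_Y ∇_X s - ∇_{[X, Y]} s`, for vector fields `X, Y` on `M`
and a section `s` of `V`. -/
def curvatureOfFields (nabla : CovariantDerivative 𝓘(ℝ, EM) (QSpace k) V)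
    (X Y : ∀ x : M, TangentSpace 𝓘(ℝ, EM) x) (s : ∀ x, V x) (x : M) : V x :=
  nabla (fun y => nabla s y (Y y)) x (X x) - nabla (fun y => nabla s y (X y)) x (Y x)
    - nabla s x (VectorField.mlieBracket 𝓘(ℝ, EM) X Y x)

/-- The curvature form `R` of `∇` at `x`, evaluated on `X, Y ∈ T_xM` and `v ∈ V x`: the value at `x`
of `R(X, Y) v` computed with extensions of `X, Y, v` which are smooth near `x` (the choice is
irrelevant, as the curvature is tensorial). -/
def curvature (nabla : CovariantDerivative 𝓘(ℝ, EM) (QSpace k) V)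
    (x : M) (X Y : TangentSpace 𝓘(ℝ, EM) x) (v : V x) : V x :=
  curvatureOfFields nabla (FiberBundle.extend EM X) (FiberBundle.extend EM Y)
    (FiberBundle.extend (QSpace k) v) x

/-- The complex multilinear extension of `(e₁, e₂, e₃) ↦ R(ρ(e₁), ρ(e₂)) e₃`. -/
def curvatureRhoC
    (nabla : CovariantDerivative 𝓘(ℝ, EM) (QSpace k) V)
    (ρ : ∀ x : M, V x →ₗ[ℝ] TangentSpace 𝓘(ℝ, EM) x) (x : M) (e₁ e₂ e₃ : V x × V x) : V x × V x :=
  complexify₂ (fun (f : V x → V x) (v : V x) => f v)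
    (complexify₂ (fun u v => curvature nabla x (ρ x u) (ρ x v)) e₁ e₂) e₃

/-- The connection `∇` satisfies the first Bianchi identity with respect to the bundle `Z` of
admissible linear complex structures of `V`, where `J ∈ Z` is identified with the complex subspace
`E^J = ker (J + i)` of the complexified fibre: `∇` is torsion free and
`R(ρ(e₁), ρ(e₂)) e₃ + R(ρ(e₂), ρ(e₃)) e₁ + R(ρ(e₃), ρ(e₁)) e₂ = 0` for all `J ∈ Z` and
`e₁, e₂, e₃ ∈ E^J`. -/
structure SatisfiesFirstBianchi
    (nabla : CovariantDerivative 𝓘(ℝ, EM) (QSpace k) V)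
    (ρ : ∀ x : M, V x →ₗ[ℝ] TangentSpace 𝓘(ℝ, EM) x) : Prop where
  torsionFree : IsTorsionFree nabla ρ
  bianchi : ∀ x, ∀ J ∈ admissible k V x, ∀ e₁ ∈ kerAddI J, ∀ e₂ ∈ kerAddI J, ∀ e₃ ∈ kerAddI J,
    curvatureRhoC nabla ρ x e₁ e₂ e₃ + curvatureRhoC nabla ρ x e₂ e₃ e₁
      + curvatureRhoC nabla ρ x e₃ e₁ e₂ = 0

/-! ### The almost co-CR structure on the bundle of admissible linear complex structures

Over the base set of a trivialization `e` of the atlas of `V`, the bundle `Z` is identified with a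
product with `S2`, through `(x, a) ↦ (x, trivJ e x a)`. These identifications are the
trivializations of the associated bundle `Z`, and all the objects below are written in them. -/

/-- The tangent space to `M × S2`. -/
abbrev TZ (z : M × S2) : Type _ := TangentSpace (𝓘(ℝ, EM).prod (𝓡 2)) z

/-- The differential of the projection `π : Z → M`. -/
def dπ (z : M × S2) (ξ : TZ (EM := EM) z) : TangentSpace 𝓘(ℝ, EM) z.1 :=
  mfderiv (𝓘(ℝ, EM).prod (𝓡 2)) 𝓘(ℝ, EM) (Prod.fst : M × S2 → M) z ξ

/-- The component along `S2` of a vector tangent to `M × S2`, as an imaginary quaternion. -/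
def dS (z : M × S2) (ξ : TZ (EM := EM) z) : ℍ[ℝ] :=
  imQ (mfderiv (𝓘(ℝ, EM).prod (𝓡 2)) 𝓘(ℝ, EuclideanSpace ℝ (Fin 3))
    (fun w : M × S2 => (w.2 : EuclideanSpace ℝ (Fin 3))) z ξ)

/-- `ξ`, tangent to `Z` at `J = (x, a)`, is horizontal with respect to the connection induced by `∇`
on `Z ⊆ End V`: the covariant derivative `∇_{dπ ξ} J(·)` at `x`, of any local section `J(·)` of `Z`
tangent to `ξ` at `x`, is zero. On the section which `e` maps to the constant `q` we have
`(∇_X J) q = v q + Γ(X)(a q) - a (Γ(X) q)`, where `X = dπ ξ`, `v = dS ξ` and `Γ` is the local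
connection form. -/
def IsHorizontal (nabla : CovariantDerivative 𝓘(ℝ, EM) (QSpace k) V)
    (e : Trivialization (QSpace k) (π (QSpace k) V)) [MemTrivializationAtlas e]
    (z : M × S2) (ξ : TZ (EM := EM) z) : Prop :=
  ∀ q : QSpace k, leftMul k (dS z ξ) q
    + connForm nabla e z.1 (dπ z ξ) (leftMul k (imQ z.2) q)
    - leftMul k (imQ z.2) (connForm nabla e z.1 (dπ z ξ) q) = 0

/-- The complex subspace `ℬ_J`: the horizontal lift of `ρ (ker (J + i))`. -/
def horB (nabla : CovariantDerivative 𝓘(ℝ, EM) (QSpace k) V)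
    (ρ : ∀ x : M, V x →ₗ[ℝ] TangentSpace 𝓘(ℝ, EM) x)
    (e : Trivialization (QSpace k) (π (QSpace k) V)) [MemTrivializationAtlas e]
    (z : M × S2) : Set (TZ (EM := EM) z × TZ (EM := EM) z) :=
  {ζ | IsHorizontal nabla e z ζ.1 ∧ IsHorizontal nabla e z ζ.2 ∧
    ∃ w ∈ kerAddI (trivJ e z.1 z.2), dπ z ζ.1 = ρ z.1 w.1 ∧ dπ z ζ.2 = ρ z.1 w.2}

/-- The space `(ker dπ)^{0,1}`, with respect to the complex structure `v ↦ a v` (quaternionic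
multiplication; equivalently, the cross product with `a`) of the fibre `S2` at `a`. -/
def vert01 (z : M × S2) : Set (TZ (EM := EM) z × TZ (EM := EM) z) :=
  {ζ | dπ z ζ.1 = 0 ∧ dπ z ζ.2 = 0 ∧
    (dS z ζ.1, dS z ζ.2) ∈ kerAddI (LinearMap.mulLeft ℝ (imQ z.2))}

/-- The complex distribution `𝒞 = (ker dπ)^{0,1} ⊕ ℬ` on `Z`. -/
def distC (nabla : CovariantDerivative 𝓘(ℝ, EM) (QSpace k) V)
    (ρ : ∀ x : M, V x →ₗ[ℝ] TangentSpace 𝓘(ℝ, EM) x)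
    (e : Trivialization (QSpace k) (π (QSpace k) V)) [MemTrivializationAtlas e]
    (z : M × S2) : Set (TZ (EM := EM) z × TZ (EM := EM) z) :=
  {ζ | ∃ v ∈ vert01 z, ∃ b ∈ horB nabla ρ e z, ζ = v + b}

/-- `X` is a smooth vector field on `O ⊆ M × S2`. -/
def IsSmoothFieldOn (X : ∀ z : M × S2, TZ (EM := EM) z) (O : Set (M × S2)) : Prop :=
  ContMDiffOn (𝓘(ℝ, EM).prod (𝓡 2)) (𝓘(ℝ, EM).prod (𝓡 2)).tangent ∞
    (fun z => (⟨z, X z⟩ : TangentBundle (𝓘(ℝ, EM).prod (𝓡 2)) (M × S2))) O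

/-- `X` is a local section of `𝒞`, over `O ⊆ M × S2`: a smooth complex vector field `X.1 + i X.2`
on `O` with values in `𝒞`. -/
def IsSectionOfC (nabla : CovariantDerivative 𝓘(ℝ, EM) (QSpace k) V)
    (ρ : ∀ x : M, V x →ₗ[ℝ] TangentSpace 𝓘(ℝ, EM) x)
    (e : Trivialization (QSpace k) (π (QSpace k) V)) [MemTrivializationAtlas e]
    (O : Set (M × S2))
    (X : (∀ z : M × S2, TZ (EM := EM) z) × (∀ z : M × S2, TZ (EM := EM) z)) : Prop :=
  IsSmoothFieldOn X.1 O ∧ IsSmoothFieldOn X.2 O ∧ ∀ z ∈ O, (X.1 z, X.2 z) ∈ distC nabla ρ e z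

/-- `(V, ρ, ∇)` is integrable: the distribution `𝒞` on `Z` is integrable, that is, the Lie bracket
of any two local sections of `𝒞` takes values in `𝒞`. -/
def IsIntegrable (nabla : CovariantDerivative 𝓘(ℝ, EM) (QSpace k) V)
    (ρ : ∀ x : M, V x →ₗ[ℝ] TangentSpace 𝓘(ℝ, EM) x) : Prop :=
  ∀ (e : Trivialization (QSpace k) (π (QSpace k) V)) [MemTrivializationAtlas e]
    (O : Set (M × S2)), IsOpen O → O ⊆ e.baseSet ×ˢ univ →
    ∀ X Y : (∀ z : M × S2, TZ (EM := EM) z) × (∀ z : M × S2, TZ (EM := EM) z),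
      IsSectionOfC nabla ρ e O X → IsSectionOfC nabla ρ e O Y →
      ∀ z ∈ O,
        ((complexify₂ (VectorField.mlieBracket (𝓘(ℝ, EM).prod (𝓡 2))) X Y).1 z,
          (complexify₂ (VectorField.mlieBracket (𝓘(ℝ, EM).prod (𝓡 2))) X Y).2 z)
          ∈ distC nabla ρ e z

end Bundles

end CoCR

end

/-! Over the base set of a trivialization, `Z` is `M × S2`, and a tautological function `A(x, a) =
a` with `A² = -1` lives on it. A vector `ξ` tangent to `Z` is determined by `dπ ξ` and by its
vertical part `∇_ξ A = dS ξ + [p(ξ), a]`, where `p` is the `ℍ`-component of the connection form. In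
these terms `ζ + i ζ'` lies in `𝒞` exactly when `dπ ζ = ρ u` and `dπ ζ' = ρ (a u)` for some `u`, and
`∇_ζ' A = a ∇_ζ A` (`mem_distC_iff`). It remains to see that both conditions survive brackets.

Horizontal condition: if `dπ X = ρ u` and `dπ Y = ρ v`, absence of torsion gives `dπ [X, Y] = ρ (∇_X
v - ∇_Y u)`. The Leibniz rule for `∇ (A u)`, valid because `∇` is compatible, and the vertical
condition on the two fields then put the complex bracket in `ρ (ker (J + i))`. The kernel hypothesis
on `ρ` makes `u` and `v` unique, hence differentiable.

Vertical condition: the structure equation gives `∇_[X,Y] A = ∇_X ∇_Y A - ∇_Y ∇_X A - [Ω(X, Y), A]`,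
with `Ω` the `ℍ`-component of the curvature. The derivative terms obey the condition by the Leibniz
rule, so everything rests on `a [r, a] = [r', a]`, where `r + i r'` is `Ω` evaluated on two elements
of `ρ (ker (J + i))`.

This is where the Bianchi identity enters (`commutator_eq_of_bianchi`). The curvature is `Ω` plus an
`ℍ`-linear part, which preserves `ker (J + i)`. Projecting the identity away from `ker (J + i)`
leaves a cyclic sum `m(u, v) w + m(v, w) u + m(w, u) v = 0`, with `m` anticommuting with `a`. If
`m(u, v) ≠ 0`, every `w` lies in the span of `u, a u, v, a v`, which is impossible when the real
rank exceeds `4` (`eq_zero_of_cyclic_sum_eq_zero`). The equation `m = 0` is the required relation.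
-/

open Topology

set_option linter.unusedSectionVars false

noncomputable section

namespace CoCR

/-! ### Derivatives of vector-valued functions along vector fields and their brackets. -/

section Calculus

variable {E : Type*} [NormedAddCommGroup E] [NormedSpace ℝ E]
  {H : Type*} [TopologicalSpace H] {I : ModelWithCorners ℝ E H}
  {N : Type*} [TopologicalSpace N] [ChartedSpace H N]
  {F : Type*} [NormedAddCommGroup F] [NormedSpace ℝ F]

variable (I) in
/-- The vector field on the model space which corresponds to `V` in the chart at `z`. -/
def chartField (z : N) (V : ∀ x : N, TangentSpace I x) (p : E) : E :=
  VectorField.mpullbackWithin 𝓘(ℝ, E) I (extChartAt I z).symm V (range I) p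

/-- In the chart at `z`, the derivative of `f` along a vector field is computed by the
corresponding vector field on the model space. -/
lemma mvfderiv_apply_eq_chart [CompleteSpace E] [I.Boundaryless] [IsManifold I 1 N]
    {f : N → F} {z y : N}
    (hy : y ∈ (extChartAt I z).source) (hf : MDifferentiableAt I 𝓘(ℝ, F) f y)
    (V : ∀ x : N, TangentSpace I x)
    (hV : V y = VectorField.mpullback I 𝓘(ℝ, E) (extChartAt I z) (chartField I z V) y) :
    mvfderiv I f y (V y) = fderiv ℝ (f ∘ (extChartAt I z).symm) (extChartAt I z y)
      (chartField I z V (extChartAt I z y)) := by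
  set φ := extChartAt I z with hφ
  have hinv := isInvertible_mfderiv_extChartAt (I := I) hy
  have hφd : MDifferentiableAt I 𝓘(ℝ, E) φ y :=
    mdifferentiableAt_extChartAt (by rwa [extChartAt_source] at hy)
  have hg : MDifferentiableAt 𝓘(ℝ, E) 𝓘(ℝ, F) (f ∘ φ.symm) (φ y) := by
    have h1 : MDifferentiableAt 𝓘(ℝ, E) I φ.symm (φ y) := by
      have := mdifferentiableWithinAt_extChartAt_symm (I := I) (φ.map_source hy)
      rwa [I.range_eq_univ, mdifferentiableWithinAt_univ] at this
    refine MDifferentiableAt.comp (φ y) ?_ h1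
    rwa [φ.left_inv hy]
  have h2 : mfderiv I 𝓘(ℝ, F) (f ∘ φ.symm ∘ φ) y =
      (mfderiv 𝓘(ℝ, E) 𝓘(ℝ, F) (f ∘ φ.symm) (φ y)).comp (mfderiv I 𝓘(ℝ, E) φ y) :=
    mfderiv_comp y hg hφd
  have h3 : f =ᶠ[𝓝 y] f ∘ φ.symm ∘ φ := by
    filter_upwards [(isOpen_extChartAt_source (I := I) z).mem_nhds hy] with x hx
    simp only [Function.comp_apply]
    rw [φ.left_inv hx]
  rw [mfderiv_eq_fderiv] at h2
  have h4 : mvfderiv I f y (V y) = fderiv ℝ (f ∘ φ.symm) (φ y) (mfderiv I 𝓘(ℝ, E) φ y (V y)) := by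
    have := congrArg (fun L => L (V y)) (h3.mfderiv_eq (I := I) (I' := 𝓘(ℝ, F)))
    exact this.trans (congrArg (fun L => L (V y)) h2)
  rw [h4, hV]
  exact congrArg (fderiv ℝ (f ∘ φ.symm) (φ y)) (hinv.self_apply_inverse _)

lemma eventually_mvfderiv_apply_eq_chart [CompleteSpace E] [I.Boundaryless] [IsManifold I 1 N]
    {f : N → F} {z : N} (hf : ∀ᶠ y in 𝓝 z, MDifferentiableAt I 𝓘(ℝ, F) f y)
    (V : ∀ x : N, TangentSpace I x) :
    ∀ᶠ y in 𝓝 z, mvfderiv I f y (V y) = fderiv ℝ (f ∘ (extChartAt I z).symm) (extChartAt I z y)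
      (chartField I z V (extChartAt I z y)) := by
  have h := VectorField.eventuallyEq_mpullback_mpullbackWithin_extChartAt (I := I) (x := z)
    (s := univ) V
  rw [nhdsWithin_univ] at h
  filter_upwards [hf, h, extChartAt_source_mem_nhds (I := I) z] with y h1 h2 h3
  exact mvfderiv_apply_eq_chart h3 h1 V h2

lemma _root_.ContMDiffAt.eventually_mdifferentiableAt [IsManifold I ∞ N] {f : N → F} {z : N}
    (hf : ContMDiffAt I 𝓘(ℝ, F) ∞ f z) : ∀ᶠ y in 𝓝 z, MDifferentiableAt I 𝓘(ℝ, F) f y := by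
  have : IsManifold I 1 N := .of_le (n := ∞) ENat.LEInfty.out
  -- Smoothness of order `∞` at a point need not hold on one neighbourhood for all orders at once,
  -- whence the descent to order `1`.
  have h := (contMDiffAt_iff_contMDiffAt_nhds (by simp)).1 (ContMDiffAt.of_le hf (m := 1) (by simp))
  exact h.mono fun y hy => hy.mdifferentiableAt one_ne_zero

lemma differentiableAt_chartField [CompleteSpace E] [I.Boundaryless]
    [IsManifold I ∞ N] {z : N} {V : ∀ x : N, TangentSpace I x}
    (hV : MDifferentiableAt I I.tangent (fun x => (⟨x, V x⟩ : TangentBundle I N)) z) :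
    DifferentiableAt ℝ (chartField I z V) (extChartAt I z z) := by
  have : IsManifold I 2 N := .of_le (n := ∞) ENat.LEInfty.out
  have := MDifferentiableWithinAt.differentiableWithinAt_mpullbackWithin_vectorField
    (s := univ) (V := V) (x := z) (I := I) (by rwa [mdifferentiableWithinAt_univ])
  rw [preimage_univ, univ_inter] at this
  change DifferentiableWithinAt ℝ (chartField I z V) (range I) _ at this
  rwa [I.range_eq_univ, differentiableWithinAt_univ] at this

lemma contDiffAt_comp_extChartAt_symm [I.Boundaryless] [IsManifold I ∞ N] {f : N → F} {z : N}
    (hf : ContMDiffAt I 𝓘(ℝ, F) ∞ f z) :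
    ContDiffAt ℝ ∞ (f ∘ (extChartAt I z).symm) (extChartAt I z z) := by
  rw [contMDiffAt_iff] at hf
  have := hf.2
  rw [I.range_eq_univ, contDiffWithinAt_univ] at this
  exact this

lemma differentiableAt_fderiv_apply {f : E → F} {V : E → E} {p : E}
    (hf : ContDiffAt ℝ ∞ f p) (hV : DifferentiableAt ℝ V p) :
    DifferentiableAt ℝ (fun q => fderiv ℝ f q (V q)) p :=
  ((hf.fderiv_right (m := 1) (by rw [one_add_one_eq_two]; exact ENat.LEInfty.out)).differentiableAt
    one_ne_zero).clm_apply hV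

/-- The derivative of a smooth function along a differentiable vector field is differentiable. -/
lemma mdifferentiableAt_mvfderiv_apply [CompleteSpace E] [I.Boundaryless] [IsManifold I ∞ N]
    {f : N → F} {z : N} (hf : ContMDiffAt I 𝓘(ℝ, F) ∞ f z) {V : ∀ x : N, TangentSpace I x}
    (hV : MDifferentiableAt I I.tangent (fun x => (⟨x, V x⟩ : TangentBundle I N)) z) :
    MDifferentiableAt I 𝓘(ℝ, F) (fun y => mvfderiv I f y (V y)) z := by
  have : IsManifold I 1 N := .of_le (n := ∞) ENat.LEInfty.out
  have hd := differentiableAt_fderiv_apply (contDiffAt_comp_extChartAt_symm hf)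
    (differentiableAt_chartField hV)
  have h1 := hd.mdifferentiableAt.comp z
    (mdifferentiableAt_extChartAt (I := I) (mem_chart_source H z))
  exact h1.congr_of_eventuallyEq
    (eventually_mvfderiv_apply_eq_chart hf.eventually_mdifferentiableAt V)

/-- The derivative along the Lie bracket of two vector fields is the commutator of the
derivatives along them. -/
lemma mvfderiv_apply_mlieBracket [CompleteSpace E] [I.Boundaryless] [IsManifold I ∞ N]
    {f : N → F} {z : N} (hf : ContMDiffAt I 𝓘(ℝ, F) ∞ f z) {V W : ∀ x : N, TangentSpace I x}
    (hV : MDifferentiableAt I I.tangent (fun x => (⟨x, V x⟩ : TangentBundle I N)) z)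
    (hW : MDifferentiableAt I I.tangent (fun x => (⟨x, W x⟩ : TangentBundle I N)) z) :
    mvfderiv I f z (VectorField.mlieBracket I V W z) =
      mvfderiv I (fun y => mvfderiv I f y (W y)) z (V z)
        - mvfderiv I (fun y => mvfderiv I f y (V y)) z (W z) := by
  have : IsManifold I 1 N := .of_le (n := ∞) ENat.LEInfty.out
  set φ := extChartAt I z with hφ
  have hg := contDiffAt_comp_extChartAt_symm hf
  have hz := mem_extChartAt_source (I := I) z
  have hinv := isInvertible_mfderiv_extChartAt (I := I) hz
  have hφd : MDifferentiableAt I 𝓘(ℝ, E) φ z :=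
    mdifferentiableAt_extChartAt (I := I) (mem_chart_source H z)
  -- The chart formula for the inner derivative holds on a neighbourhood of `z`, so it may be
  -- differentiated once more. This reduces the claim to the Lie bracket on the model space.
  have key : ∀ {V W : ∀ x : N, TangentSpace I x},
      MDifferentiableAt I I.tangent (fun x => (⟨x, W x⟩ : TangentBundle I N)) z →
      mvfderiv I (fun y => mvfderiv I f y (W y)) z (V z) =
        fderiv ℝ (fun q => fderiv ℝ (f ∘ φ.symm) q
          (chartField I z W q)) (φ z)
          (chartField I z V (φ z)) := by
    intro V W hW
    have hev := eventually_mvfderiv_apply_eq_chart hf.eventually_mdifferentiableAt W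
    have hd := differentiableAt_fderiv_apply hg
      (differentiableAt_chartField hW)
    have h2 := mfderiv_comp z hd.mdifferentiableAt hφd
    rw [mfderiv_eq_fderiv] at h2
    have h4 := congrArg (fun L => L (V z)) (Filter.EventuallyEq.mfderiv_eq (I := I)
      (I' := 𝓘(ℝ, F)) (f₁ := fun y => mvfderiv I f y (W y)) hev)
    refine (h4.trans (congrArg (fun L => L (V z)) h2)).trans ?_
    have h := VectorField.eventuallyEq_mpullback_mpullbackWithin_extChartAt (I := I) (x := z)
      (s := univ) V
    rw [nhdsWithin_univ] at h
    change V =ᶠ[𝓝 z] VectorField.mpullback I 𝓘(ℝ, E) φ (chartField I z V) at h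
    have h5 : mfderiv I 𝓘(ℝ, E) φ z (V z) =
        chartField I z V (φ z) := by
      rw [h.self_of_nhds]
      exact hinv.self_apply_inverse _
    rw [← h5]
    rfl
  rw [key hW, key hV, ← VectorField.fderiv_apply_lieBracket hg (by simpa using ENat.LEInfty.out)
    (differentiableAt_chartField hW)
    (differentiableAt_chartField hV)]
  have hd := mfderiv_comp (I'' := 𝓘(ℝ, F)) z
    ((hg.differentiableAt (by simp)).mdifferentiableAt) hφd
  rw [mfderiv_eq_fderiv] at hd
  have h3 : f =ᶠ[𝓝 z] (f ∘ φ.symm) ∘ φ := by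
    filter_upwards [extChartAt_source_mem_nhds (I := I) z] with x hx
    simp only [Function.comp_apply]
    rw [φ.left_inv hx]
  have h4 := congrArg (fun L => L (VectorField.mlieBracket I V W z)) (h3.mfderiv_eq (I := I)
    (I' := 𝓘(ℝ, F)))
  refine (h4.trans (congrArg (fun L => L (VectorField.mlieBracket I V W z)) hd)).trans ?_
  have h5 : mfderiv I 𝓘(ℝ, E) φ z (VectorField.mlieBracket I V W z) =
      VectorField.lieBracket ℝ (chartField I z V) (chartField I z W) (φ z) := by
    rw [← VectorField.mlieBracketWithin_univ, VectorField.mlieBracketWithin_apply]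
    refine (hinv.self_apply_inverse _).trans ?_
    rw [preimage_univ, univ_inter]
    change VectorField.lieBracketWithin ℝ (chartField I z V) (chartField I z W) (range I) _ = _
    rw [I.range_eq_univ, VectorField.lieBracketWithin_univ]
  rw [← h5]
  rfl

variable {G K : Type*} [NormedAddCommGroup G] [NormedSpace ℝ G]
  [NormedAddCommGroup K] [NormedSpace ℝ K]

lemma mvfderiv_differentiable_comp {f : N → F} {h : F → G} {z : N}
    (hh : DifferentiableAt ℝ h (f z)) (hf : MDifferentiableAt I 𝓘(ℝ, F) f z)
    (ξ : TangentSpace I z) :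
    mvfderiv I (fun y => h (f y)) z ξ = fderiv ℝ h (f z) (mvfderiv I f z ξ) := by
  have := mfderiv_comp z hh.mdifferentiableAt hf
  rw [mfderiv_eq_fderiv] at this
  exact congrArg (fun L => L ξ) this

lemma mdifferentiableAt_clm_comp {f : N → F} (L : F →L[ℝ] G) {z : N}
    (hf : MDifferentiableAt I 𝓘(ℝ, F) f z) :
    MDifferentiableAt I 𝓘(ℝ, G) (fun y => L (f y)) z :=
  L.differentiableAt.mdifferentiableAt.comp z hf

lemma mvfderiv_clm_comp {f : N → F} (L : F →L[ℝ] G) {z : N}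
    (hf : MDifferentiableAt I 𝓘(ℝ, F) f z) (ξ : TangentSpace I z) :
    mvfderiv I (fun y => L (f y)) z ξ = L (mvfderiv I f z ξ) := by
  rw [mvfderiv_differentiable_comp L.differentiableAt hf, L.fderiv]

lemma mdifferentiableAt_bilin (B : F →L[ℝ] G →L[ℝ] K) {f : N → F} {g : N → G} {z : N}
    (hf : MDifferentiableAt I 𝓘(ℝ, F) f z) (hg : MDifferentiableAt I 𝓘(ℝ, G) g z) :
    MDifferentiableAt I 𝓘(ℝ, K) (fun y => B (f y) (g y)) z :=
  (mdifferentiableAt_clm_comp B hf).clm_apply hg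

lemma mvfderiv_bilin (B : F →L[ℝ] G →L[ℝ] K) {f : N → F} {g : N → G} {z : N}
    (hf : MDifferentiableAt I 𝓘(ℝ, F) f z) (hg : MDifferentiableAt I 𝓘(ℝ, G) g z)
    (ξ : TangentSpace I z) :
    mvfderiv I (fun y => B (f y) (g y)) z ξ =
      B (mvfderiv I f z ξ) (g z) + B (f z) (mvfderiv I g z ξ) := by
  have hB : DifferentiableAt ℝ (fun p : F × G => B p.1 p.2) (f z, g z) :=
    B.isBoundedBilinearMap.differentiableAt _
  have hp := hf.prodMk_space hg
  refine (mvfderiv_differentiable_comp (f := fun y => (f y, g y)) hB hp ξ).trans ?_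
  have h1 : mvfderiv I (fun y => (f y, g y)) z ξ = (mvfderiv I f z ξ, mvfderiv I g z ξ) := by
    have h1 := mvfderiv_clm_comp (ContinuousLinearMap.fst ℝ F G) hp ξ
    have h2 := mvfderiv_clm_comp (ContinuousLinearMap.snd ℝ F G) hp ξ
    exact Prod.ext h1.symm h2.symm
  rw [h1, (B.isBoundedBilinearMap.hasFDerivAt (f z, g z)).fderiv,
    IsBoundedBilinearMap.deriv_apply, add_comm]

lemma mvfderiv_clm_apply {f : N → F →L[ℝ] G} {g : N → F} {z : N}
    (hf : MDifferentiableAt I 𝓘(ℝ, F →L[ℝ] G) f z) (hg : MDifferentiableAt I 𝓘(ℝ, F) g z)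
    (ξ : TangentSpace I z) :
    mvfderiv I (fun y => f y (g y)) z ξ = mvfderiv I f z ξ (g z) + f z (mvfderiv I g z ξ) :=
  mvfderiv_bilin (ContinuousLinearMap.id ℝ (F →L[ℝ] G)) hf hg ξ

lemma _root_.Filter.EventuallyEq.mvfderiv_eq {f g : N → F} {z : N} (h : f =ᶠ[𝓝 z] g)
    (ξ : TangentSpace I z) : mvfderiv I f z ξ = mvfderiv I g z ξ :=
  congrArg (fun L => L ξ) (h.mfderiv_eq (I := I) (I' := 𝓘(ℝ, F)))

end Calculus

/-! ### Quaternionic linear algebra on `ℍᵏ`. -/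

section Algebra

variable {k : ℕ}

/-- Left multiplication by quaternions on `ℍᵏ`. -/
def leftMulL (k : ℕ) : ℍ[ℝ] →L[ℝ] QSpace k →L[ℝ] QSpace k := ContinuousLinearMap.lsmul ℝ ℍ[ℝ]

@[simp] lemma leftMulL_apply (a : ℍ[ℝ]) (q : QSpace k) : leftMulL k a q = a • q := rfl

lemma leftMul_apply (a : ℍ[ℝ]) (q : QSpace k) : leftMul k a q = a • q := rfl

@[simp] lemma imQ_re (v : EuclideanSpace ℝ (Fin 3)) : (imQ v).re = 0 := rfl
@[simp] lemma imQ_imI (v : EuclideanSpace ℝ (Fin 3)) : (imQ v).imI = v 0 := rfl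
@[simp] lemma imQ_imJ (v : EuclideanSpace ℝ (Fin 3)) : (imQ v).imJ = v 1 := rfl
@[simp] lemma imQ_imK (v : EuclideanSpace ℝ (Fin 3)) : (imQ v).imK = v 2 := rfl

/-- The imaginary quaternion `i`. -/
def unitI : ℍ[ℝ] := imQ !₂[1, 0, 0]

/-- The imaginary quaternion `j`. -/
def unitJ : ℍ[ℝ] := imQ !₂[0, 1, 0]

/-- The imaginary quaternion `k`. -/
def unitK : ℍ[ℝ] := imQ !₂[0, 0, 1]

/-- The linear map `imQ`. -/
def imQL : EuclideanSpace ℝ (Fin 3) →L[ℝ] ℍ[ℝ] :=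
  LinearMap.toContinuousLinearMap
    { toFun := imQ
      map_add' := fun v w => by ext <;> simp
      map_smul' := fun c v => by ext <;> simp }

@[simp] lemma imQL_apply (v : EuclideanSpace ℝ (Fin 3)) : imQL v = imQ v := rfl

lemma imQ_mul_self (a : S2) : imQ a * imQ a = -1 := by
  have h : ‖(a : EuclideanSpace ℝ (Fin 3))‖ ^ 2 = 1 := by simp
  rw [EuclideanSpace.norm_sq_eq] at h
  simp only [Real.norm_eq_abs, sq_abs, Fin.sum_univ_three] at h
  ext
  · simp; linarith
  all_goals simp; ring

lemma imQ_smul_imQ_smul (a : S2) (q : QSpace k) : imQ a • imQ a • q = -q := by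
  rw [smul_smul, imQ_mul_self, neg_smul, one_smul]

/-- An auxiliary term of `leftPart`: it maps `q ↦ p q + q B` to `(p c - c p) c`. -/
def commMul [NeZero k] (c : ℍ[ℝ]) : (QSpace k →L[ℝ] QSpace k) →L[ℝ] ℍ[ℝ] :=
  ((ContinuousLinearMap.mul ℝ ℍ[ℝ]).flip c) ∘L (ContinuousLinearMap.proj (0 : Fin k)) ∘L
    (ContinuousLinearMap.apply ℝ (QSpace k) (c • fun _ => 1) -
      leftMulL k c ∘L ContinuousLinearMap.apply ℝ (QSpace k) (fun _ => 1))

lemma commMul_apply [NeZero k] (c : ℍ[ℝ]) (G : QSpace k →L[ℝ] QSpace k) :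
    commMul c G = (G (c • fun _ => 1) - c • G (fun _ => 1)) 0 * c := rfl

/-- The component `p` of an endomorphism of `ℍᵏ` of the form `q ↦ p q + q B`, with `p` an imaginary
quaternion. -/
def leftPart [NeZero k] : (QSpace k →L[ℝ] QSpace k) →L[ℝ] ℍ[ℝ] :=
  -- For imaginary `p`, the sum of `c p c` over `c = i, j, k` is `p`, and that of `p c c` is `-3 p`;
  -- hence the sum of `(p c - c p) c` is `-4 p`.
  (-(1 / 4 : ℝ)) • (commMul unitI + commMul unitJ + commMul unitK)

/-- Right multiplication by `B` commutes with left multiplications, so it cancels in `G (c • q) - c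
• G q`. This makes `p` independent of the choice of `(p, B)` and gives it by a formula linear and
continuous in `G`, so that it can be differentiated. -/
lemma leftPart_eq [NeZero k] {G : QSpace k →L[ℝ] QSpace k} {p : EuclideanSpace ℝ (Fin 3)}
    {B : Matrix (Fin k) (Fin k) ℍ[ℝ]}
    (hG : ∀ q, G q = leftMul k (imQ p) q + Matrix.vecMul q B) : leftPart G = imQ p := by
  have h (c : ℍ[ℝ]) : commMul c G = (imQ p * c - c * imQ p) * c := by
    rw [commMul_apply, hG, hG, Matrix.smul_vecMul, smul_add, add_sub_add_right_eq_sub]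
    simp [leftMul_apply]
  change (-(1 / 4 : ℝ)) • (commMul unitI G + commMul unitJ G + commMul unitK G) = _
  rw [h, h, h]
  ext <;> simp [unitI, unitJ, unitK] <;> ring

/-- The endomorphisms of `ℍᵏ` of the form `q ↦ p q + q B`, up to their component `p`, commute with
left multiplications. -/
lemma leftPart_spec [NeZero k] {G : QSpace k →L[ℝ] QSpace k}
    (hG : ∃ (p : EuclideanSpace ℝ (Fin 3)) (B : Matrix (Fin k) (Fin k) ℍ[ℝ]),
      ∀ q, G q = leftMul k (imQ p) q + Matrix.vecMul q B) (c : ℍ[ℝ]) (q : QSpace k) :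
    G (c • q) - leftPart G • c • q = c • (G q - leftPart G • q) := by
  obtain ⟨p, B, hG⟩ := hG
  rw [leftPart_eq hG, hG, hG, leftMul_apply, leftMul_apply, Matrix.smul_vecMul]
  simp

/-- A quaternion which commutes with the imaginary unit `a` is in `ℝ + ℝ a`. -/
lemma exists_eq_add_smul_of_commute (a : S2) {c : ℍ[ℝ]} (hc : c * imQ a = imQ a * c) :
    ∃ x y : ℝ, c = x • (1 : ℍ[ℝ]) + y • imQ a := by
  have h : ‖(a : EuclideanSpace ℝ (Fin 3))‖ ^ 2 = 1 := by simp
  rw [EuclideanSpace.norm_sq_eq] at h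
  simp only [Real.norm_eq_abs, sq_abs, Fin.sum_univ_three] at h
  -- Commuting with `a` makes the imaginary part of `c` parallel to `a`; as `a` has length `1`, the
  -- coefficient is their inner product.
  refine ⟨c.re, c.imI * a.1 0 + c.imJ * a.1 1 + c.imK * a.1 2, ?_⟩
  have h1 := congrArg QuaternionAlgebra.imI hc
  have h2 := congrArg QuaternionAlgebra.imJ hc
  have h3 := congrArg QuaternionAlgebra.imK hc
  simp at h1 h2 h3
  ext
  · simp
  · simp; linear_combination (-c.imI) * h + (a.1 1 / 2) * h3 - (a.1 2 / 2) * h2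
  · simp; linear_combination (-c.imJ) * h - (a.1 0 / 2) * h3 + (a.1 2 / 2) * h1
  · simp; linear_combination (-c.imK) * h + (a.1 0 / 2) * h2 - (a.1 1 / 2) * h1

/-- If `ℍᵏ` has real dimension greater than `4`, a cyclic identity for forms with values in the
quaternions anticommuting with `a` is trivial. -/
lemma eq_zero_of_cyclic_sum_eq_zero (hrank : 4 < Module.finrank ℝ (QSpace k)) (a : S2)
    (m : QSpace k → QSpace k → ℍ[ℝ]) (hm : ∀ u v, m u v * imQ a = -(imQ a * m u v))
    (h : ∀ u v w, m u v • w + m v w • u + m w u • v = 0) (u v : QSpace k) : m u v = 0 := by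
  by_contra hne
  -- The span of `u` and `v` over the copy `ℝ + ℝ a` of the complex numbers, of real dimension at
  -- most `4`.
  let S := Submodule.span ℝ (Set.range ![u, imQ a • u, v, imQ a • v])
  have key (n : ℍ[ℝ]) (hn : n * imQ a = -(imQ a * n)) (w : QSpace k)
      (hw : w ∈ S ∧ imQ a • w ∈ S) : ((m u v)⁻¹ * n) • w ∈ S := by
    -- A product of two quaternions anticommuting with `a` commutes with `a`, hence lies in `ℝ + ℝ
    -- a` and acts within `S`.
    have hc : ((m u v)⁻¹ * n) * imQ a = imQ a * ((m u v)⁻¹ * n) := by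
      have : imQ a * (m u v)⁻¹ = -((m u v)⁻¹ * imQ a) := by
        have h2 := hm u v
        calc imQ a * (m u v)⁻¹ = (m u v)⁻¹ * (m u v * imQ a) * (m u v)⁻¹ := by
              rw [← mul_assoc, inv_mul_cancel₀ hne, one_mul]
          _ = _ := by
              rw [h2, mul_neg, neg_mul, mul_assoc, mul_assoc, mul_inv_cancel₀ hne, mul_one]
      rw [← mul_assoc, this, mul_assoc, hn, mul_neg, neg_mul, mul_assoc]
    obtain ⟨x, y, hxy⟩ := exists_eq_add_smul_of_commute a hc
    rw [hxy, add_smul, smul_assoc, smul_assoc, one_smul]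
    exact S.add_mem (S.smul_mem _ hw.1) (S.smul_mem _ hw.2)
  have hmem (i : Fin 4) : ![u, imQ a • u, v, imQ a • v] i ∈ S := Submodule.subset_span ⟨i, rfl⟩
  have htop : S = ⊤ := by
    rw [eq_top_iff]
    intro w _
    -- The cyclic identity is solved for an arbitrary `w`, with coefficients of the form treated in
    -- `key`.
    have h1 : m u v • w = -(m v w • u + m w u • v) := by
      rw [eq_neg_iff_add_eq_zero, ← add_assoc]; exact h u v w
    have h2 : w = -(((m u v)⁻¹ * m v w) • u + ((m u v)⁻¹ * m w u) • v) := by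
      rw [mul_smul, mul_smul, ← smul_add, ← smul_neg, ← h1, smul_smul, inv_mul_cancel₀ hne,
        one_smul]
    rw [h2]
    exact S.neg_mem (S.add_mem (key _ (hm _ _) u ⟨hmem 0, hmem 1⟩)
      (key _ (hm _ _) v ⟨hmem 2, hmem 3⟩))
  have hle : Module.finrank ℝ S ≤ 4 := by
    exact (finrank_range_le_card (R := ℝ) ![u, imQ a • u, v, imQ a • v]).trans (by simp)
  rw [htop, finrank_top] at hle
  omega

end Algebra

/-! ### The bracket computation for abstract local data `φ, A, R, Γ`. -/

section LocalData

variable {E : Type*} [NormedAddCommGroup E] [NormedSpace ℝ E]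
  {H : Type*} [TopologicalSpace H] {I : ModelWithCorners ℝ E H}
  {N : Type*} [TopologicalSpace N] [ChartedSpace H N]
  {F : Type*} [NormedAddCommGroup F] [NormedSpace ℝ F]
  {Q : Type*} [NormedAddCommGroup Q] [NormedSpace ℝ Q] [Module ℍ[ℝ] Q] [IsBoundedSMul ℍ[ℝ] Q]
  [IsScalarTower ℝ ℍ[ℝ] Q]

lemma mvfderiv_mul_quaternion {f g : N → ℍ[ℝ]} {z : N}
    (hf : MDifferentiableAt I 𝓘(ℝ, ℍ[ℝ]) f z) (hg : MDifferentiableAt I 𝓘(ℝ, ℍ[ℝ]) g z)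
    (ξ : TangentSpace I z) : mvfderiv I (fun y => f y * g y) z ξ =
      mvfderiv I f z ξ * g z + f z * mvfderiv I g z ξ :=
  mvfderiv_bilin (ContinuousLinearMap.mul ℝ ℍ[ℝ]) hf hg ξ

lemma mdifferentiableAt_mul_quaternion {f g : N → ℍ[ℝ]} {z : N}
    (hf : MDifferentiableAt I 𝓘(ℝ, ℍ[ℝ]) f z) (hg : MDifferentiableAt I 𝓘(ℝ, ℍ[ℝ]) g z) :
    MDifferentiableAt I 𝓘(ℝ, ℍ[ℝ]) (fun y => f y * g y) z :=
  mdifferentiableAt_bilin (ContinuousLinearMap.mul ℝ ℍ[ℝ]) hf hg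

lemma mvfderiv_smul_quaternion {f : N → ℍ[ℝ]} {g : N → Q} {z : N}
    (hf : MDifferentiableAt I 𝓘(ℝ, ℍ[ℝ]) f z) (hg : MDifferentiableAt I 𝓘(ℝ, Q) g z)
    (ξ : TangentSpace I z) : mvfderiv I (fun y => f y • g y) z ξ =
      mvfderiv I f z ξ • g z + f z • mvfderiv I g z ξ :=
  mvfderiv_bilin ((ContinuousLinearMap.lsmul ℝ ℍ[ℝ])) hf hg ξ

lemma mdifferentiableAt_smul_quaternion {f : N → ℍ[ℝ]} {g : N → Q} {z : N}
    (hf : MDifferentiableAt I 𝓘(ℝ, ℍ[ℝ]) f z) (hg : MDifferentiableAt I 𝓘(ℝ, Q) g z) :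
    MDifferentiableAt I 𝓘(ℝ, Q) (fun y => f y • g y) z :=
  mdifferentiableAt_bilin ((ContinuousLinearMap.lsmul ℝ ℍ[ℝ])) hf hg

/-- A map `φ` to a vector space, a map `A` to the imaginary units of `ℍ`, a linear map `R` from
`ℍᵏ` and a connection form `Γ` on `ℍᵏ` over a manifold, which satisfy at `z` the conditions of
compatibility and of absence of torsion. -/
structure IsLocalModelAt (I : ModelWithCorners ℝ E H) (φ : N → F) (A : N → ℍ[ℝ])
    (R : N → Q →L[ℝ] F) (Γ : N → F →L[ℝ] Q →L[ℝ] Q)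
    (P : (Q →L[ℝ] Q) →L[ℝ] ℍ[ℝ]) (z : N) : Prop where
  contMDiffAt_base : ContMDiffAt I 𝓘(ℝ, F) ∞ φ z
  contMDiffAt_unit : ContMDiffAt I 𝓘(ℝ, ℍ[ℝ]) ∞ A z
  mdifferentiableAt_anchor : MDifferentiableAt I 𝓘(ℝ, Q →L[ℝ] F) R z
  mdifferentiableAt_form :
    MDifferentiableAt I 𝓘(ℝ, F →L[ℝ] Q →L[ℝ] Q) Γ z
  unit_mul_self : ∀ y, A y * A y = -1
  -- After removal of left multiplication by its component `P (Γ z v)`, the connection form is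
  -- `ℍ`-linear.
  compatible : ∀ (v : F) (c : ℍ[ℝ]) (q : Q), Γ z v (c • q) - P (Γ z v) • c • q =
    c • (Γ z v q - P (Γ z v) • q)
  -- The torsion equation for sections with constant coordinates `q, q'`: the bracket of their
  -- images is the difference of derivatives of `R` on the right.
  torsion : ∀ (ξ η : TangentSpace I z) (q q' : Q),
    mvfderiv I φ z ξ = R z q → mvfderiv I φ z η = R z q' →
      R z (Γ z (mvfderiv I φ z ξ) q' - Γ z (mvfderiv I φ z η) q) =
        mvfderiv I R z ξ q' - mvfderiv I R z η q

/-- The covariant derivative of a function with values in `ℍᵏ`. -/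
def covDeriv (I : ModelWithCorners ℝ E H) (φ : N → F)
    (Γ : N → F →L[ℝ] Q →L[ℝ] Q) (f : N → Q) (z : N)
    (ξ : TangentSpace I z) : Q :=
  mvfderiv I f z ξ + Γ z (mvfderiv I φ z ξ) (f z)

/-- The `ℍ`-component of the connection form. -/
def formPart (I : ModelWithCorners ℝ E H) (φ : N → F)
    (Γ : N → F →L[ℝ] Q →L[ℝ] Q)
    (P : (Q →L[ℝ] Q) →L[ℝ] ℍ[ℝ]) (z : N) (ξ : TangentSpace I z) : ℍ[ℝ] :=
  P (Γ z (mvfderiv I φ z ξ))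

/-- The covariant derivative of `A`. -/
def vertPart (I : ModelWithCorners ℝ E H) (φ : N → F) (A : N → ℍ[ℝ])
    (Γ : N → F →L[ℝ] Q →L[ℝ] Q)
    (P : (Q →L[ℝ] Q) →L[ℝ] ℍ[ℝ]) (z : N) (ξ : TangentSpace I z) : ℍ[ℝ] :=
  mvfderiv I A z ξ + (formPart I φ Γ P z ξ * A z - A z * formPart I φ Γ P z ξ)

/-- The covariant derivative of a quaternionic function. -/
def covDerivQ (I : ModelWithCorners ℝ E H) (φ : N → F)
    (Γ : N → F →L[ℝ] Q →L[ℝ] Q)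
    (P : (Q →L[ℝ] Q) →L[ℝ] ℍ[ℝ]) (f : N → ℍ[ℝ]) (z : N)
    (ξ : TangentSpace I z) : ℍ[ℝ] :=
  mvfderiv I f z ξ + (formPart I φ Γ P z ξ * f z - f z * formPart I φ Γ P z ξ)

/-- The `ℍ`-component of the curvature form. -/
def curvPart (I : ModelWithCorners ℝ E H) (φ : N → F)
    (Γ : N → F →L[ℝ] Q →L[ℝ] Q)
    (P : (Q →L[ℝ] Q) →L[ℝ] ℍ[ℝ]) (z : N) (ξ η : TangentSpace I z) : ℍ[ℝ] :=
  P (mvfderiv I Γ z ξ (mvfderiv I φ z η) - mvfderiv I Γ z η (mvfderiv I φ z ξ)) +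
    (formPart I φ Γ P z ξ * formPart I φ Γ P z η - formPart I φ Γ P z η * formPart I φ Γ P z ξ)

namespace IsLocalModelAt

variable {φ : N → F} {A : N → ℍ[ℝ]} {R : N → Q →L[ℝ] F}
  {Γ : N → F →L[ℝ] Q →L[ℝ] Q}
  {P : (Q →L[ℝ] Q) →L[ℝ] ℍ[ℝ]} {z : N}

lemma mdifferentiableAt_unit (h : IsLocalModelAt I φ A R Γ P z) :
    MDifferentiableAt I 𝓘(ℝ, ℍ[ℝ]) A z := h.contMDiffAt_unit.mdifferentiableAt (by simp)

/-- The Leibniz rule. By compatibility the connection form fails to commute with `A` only through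
its component, and the commutator of that component with `A` is what completes `dA` to `vertPart`.
-/
lemma covDeriv_unit_smul (h : IsLocalModelAt I φ A R Γ P z) {u : N → Q}
    (hu : MDifferentiableAt I 𝓘(ℝ, Q) u z) (ξ : TangentSpace I z) :
    covDeriv I φ Γ (fun y => A y • u y) z ξ =
      vertPart I φ A Γ P z ξ • u z + A z • covDeriv I φ Γ u z ξ := by
  have h1 := h.compatible (mvfderiv I φ z ξ) (A z) (u z)
  simp only [covDeriv, vertPart, formPart, mvfderiv_smul_quaternion h.mdifferentiableAt_unit hu]
  rw [sub_eq_iff_eq_add] at h1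
  rw [h1]
  simp only [smul_sub, add_smul, sub_smul, smul_add, smul_smul]
  abel

/-- Commutation with the component is a derivation of `ℍ`, so the Leibniz rule holds. -/
lemma covDerivQ_unit_mul (h : IsLocalModelAt I φ A R Γ P z) {f : N → ℍ[ℝ]}
    (hf : MDifferentiableAt I 𝓘(ℝ, ℍ[ℝ]) f z) (ξ : TangentSpace I z) :
    covDerivQ I φ Γ P (fun y => A y * f y) z ξ =
      vertPart I φ A Γ P z ξ * f z + A z * covDerivQ I φ Γ P f z ξ := by
  simp only [covDerivQ, vertPart, mvfderiv_mul_quaternion h.mdifferentiableAt_unit hf]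
  noncomm_ring

variable [CompleteSpace E] [I.Boundaryless] [IsManifold I ∞ N]

/-- The horizontal component of the bracket of two vector fields with `dφ X = R u`, `dφ Y = R v`. -/
lemma mvfderiv_base_mlieBracket (h : IsLocalModelAt I φ A R Γ P z)
    {X Y : ∀ y : N, TangentSpace I y}
    (hX : MDifferentiableAt I I.tangent (fun x => (⟨x, X x⟩ : TangentBundle I N)) z)
    (hY : MDifferentiableAt I I.tangent (fun x => (⟨x, Y x⟩ : TangentBundle I N)) z)
    {u v : N → Q} (hu : MDifferentiableAt I 𝓘(ℝ, Q) u z)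
    (hv : MDifferentiableAt I 𝓘(ℝ, Q) v z)
    (hXu : ∀ᶠ y in 𝓝 z, mvfderiv I φ y (X y) = R y (u y))
    (hYv : ∀ᶠ y in 𝓝 z, mvfderiv I φ y (Y y) = R y (v y)) :
    mvfderiv I φ z (VectorField.mlieBracket I X Y z) =
      R z (covDeriv I φ Γ v z (X z) - covDeriv I φ Γ u z (Y z)) := by
  rw [mvfderiv_apply_mlieBracket h.contMDiffAt_base hX hY,
    Filter.EventuallyEq.mvfderiv_eq (f := fun y => mvfderiv I φ y (Y y)) hYv,
    Filter.EventuallyEq.mvfderiv_eq (f := fun y => mvfderiv I φ y (X y)) hXu,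
    mvfderiv_clm_apply h.mdifferentiableAt_anchor hu,
    mvfderiv_clm_apply h.mdifferentiableAt_anchor hv]
  -- The terms in which `R` is differentiated are replaced by connection terms, which complete `dv`
  -- and `du` to covariant derivatives.
  have ht := h.torsion (X z) (Y z) (u z) (v z) hXu.self_of_nhds hYv.self_of_nhds
  have : covDeriv I φ Γ v z (X z) - covDeriv I φ Γ u z (Y z) =
      (mvfderiv I v z (X z) - mvfderiv I u z (Y z)) +
      (Γ z (mvfderiv I φ z (X z)) (v z) - Γ z (mvfderiv I φ z (Y z)) (u z)) := by
    simp only [covDeriv]; abel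
  rw [this, map_add, ht, map_sub]
  abel

lemma mdifferentiableAt_formPart (h : IsLocalModelAt I φ A R Γ P z)
    {X : ∀ y : N, TangentSpace I y}
    (hX : MDifferentiableAt I I.tangent (fun x => (⟨x, X x⟩ : TangentBundle I N)) z) :
    MDifferentiableAt I 𝓘(ℝ, ℍ[ℝ]) (fun y => formPart I φ Γ P y (X y)) z :=
  mdifferentiableAt_clm_comp P
    (h.mdifferentiableAt_form.clm_apply (mdifferentiableAt_mvfderiv_apply h.contMDiffAt_base hX))

lemma mdifferentiableAt_vertPart (h : IsLocalModelAt I φ A R Γ P z)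
    {X : ∀ y : N, TangentSpace I y}
    (hX : MDifferentiableAt I I.tangent (fun x => (⟨x, X x⟩ : TangentBundle I N)) z) :
    MDifferentiableAt I 𝓘(ℝ, ℍ[ℝ]) (fun y => vertPart I φ A Γ P y (X y)) z :=
  (mdifferentiableAt_mvfderiv_apply h.contMDiffAt_unit hX).add
    ((mdifferentiableAt_mul_quaternion (h.mdifferentiableAt_formPart hX)
      h.mdifferentiableAt_unit).sub (mdifferentiableAt_mul_quaternion h.mdifferentiableAt_unit
        (h.mdifferentiableAt_formPart hX)))

/-- Cartan's formula for the exterior derivative of the component of the connection form: the second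
derivatives of `φ` assemble into the term with the bracket. -/
lemma mvfderiv_formPart_sub (h : IsLocalModelAt I φ A R Γ P z)
    {X Y : ∀ y : N, TangentSpace I y}
    (hX : MDifferentiableAt I I.tangent (fun x => (⟨x, X x⟩ : TangentBundle I N)) z)
    (hY : MDifferentiableAt I I.tangent (fun x => (⟨x, Y x⟩ : TangentBundle I N)) z) :
    mvfderiv I (fun y => formPart I φ Γ P y (Y y)) z (X z) -
      mvfderiv I (fun y => formPart I φ Γ P y (X y)) z (Y z) =
    P (mvfderiv I Γ z (X z) (mvfderiv I φ z (Y z)) -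
      mvfderiv I Γ z (Y z) (mvfderiv I φ z (X z))) +
      formPart I φ Γ P z (VectorField.mlieBracket I X Y z) := by
  have hdX := mdifferentiableAt_mvfderiv_apply h.contMDiffAt_base hX
  have hdY := mdifferentiableAt_mvfderiv_apply h.contMDiffAt_base hY
  simp only [formPart]
  rw [mvfderiv_clm_comp P (h.mdifferentiableAt_form.clm_apply hdX),
    mvfderiv_clm_comp P (h.mdifferentiableAt_form.clm_apply hdY),
    mvfderiv_clm_apply h.mdifferentiableAt_form hdX,
    mvfderiv_clm_apply h.mdifferentiableAt_form hdY,
    mvfderiv_apply_mlieBracket h.contMDiffAt_base hX hY]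
  simp only [map_sub, map_add]
  abel

/-- The vertical component of the bracket of two vector fields. -/
lemma vertPart_mlieBracket (h : IsLocalModelAt I φ A R Γ P z)
    {X Y : ∀ y : N, TangentSpace I y}
    (hX : MDifferentiableAt I I.tangent (fun x => (⟨x, X x⟩ : TangentBundle I N)) z)
    (hY : MDifferentiableAt I I.tangent (fun x => (⟨x, Y x⟩ : TangentBundle I N)) z) :
    vertPart I φ A Γ P z (VectorField.mlieBracket I X Y z) =
      covDerivQ I φ Γ P (fun y => vertPart I φ A Γ P y (Y y)) z (X z)
        - covDerivQ I φ Γ P (fun y => vertPart I φ A Γ P y (X y)) z (Y z)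
        - (curvPart I φ Γ P z (X z) (Y z) * A z - A z * curvPart I φ Γ P z (X z) (Y z)) := by
  have hA := h.mdifferentiableAt_unit
  -- The second derivative of `A` is expressed through the derivative of `vertPart`, by the product
  -- rule for the commutator with the component.
  have key {X Y : ∀ y : N, TangentSpace I y}
      (hY : MDifferentiableAt I I.tangent (fun x => (⟨x, Y x⟩ : TangentBundle I N)) z) :
      mvfderiv I (fun y => mvfderiv I A y (Y y)) z (X z) =
      mvfderiv I (fun y => vertPart I φ A Γ P y (Y y)) z (X z) -
        ((mvfderiv I (fun y => formPart I φ Γ P y (Y y)) z (X z) * A z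
          + formPart I φ Γ P z (Y z) * mvfderiv I A z (X z)) -
          (mvfderiv I A z (X z) * formPart I φ Γ P z (Y z) +
            A z * mvfderiv I (fun y => formPart I φ Γ P y (Y y)) z (X z))) := by
    have hf := h.mdifferentiableAt_formPart hY
    rw [← mvfderiv_mul_quaternion hf hA, ← mvfderiv_mul_quaternion hA hf]
    have e1 : mvfderiv I (fun y => vertPart I φ A Γ P y (Y y)) z (X z) =
        mvfderiv I (fun y => mvfderiv I A y (Y y)) z (X z) +
        (mvfderiv I (fun y => formPart I φ Γ P y (Y y) * A y) z (X z) -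
          mvfderiv I (fun y => A y * formPart I φ Γ P y (Y y)) z (X z)) := by
      have e2 := mvfderiv_add (mdifferentiableAt_mvfderiv_apply h.contMDiffAt_unit hY)
        ((mdifferentiableAt_mul_quaternion hf hA).sub (mdifferentiableAt_mul_quaternion hA hf))
      have e3 := mvfderiv_sub (mdifferentiableAt_mul_quaternion hf hA)
        (mdifferentiableAt_mul_quaternion hA hf)
      rw [e3] at e2
      exact congrArg (fun L => L (X z)) e2
    rw [e1]; abel
  have hb := h.mvfderiv_formPart_sub hX hY
  rw [← sub_eq_iff_eq_add'] at hb
  rw [vertPart, mvfderiv_apply_mlieBracket h.contMDiffAt_unit hX hY, key hX, key hY, ← hb]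
  simp only [covDerivQ, curvPart, vertPart]
  noncomm_ring

/-- The horizontal components of the bracket of the complex vector fields `X + i X'` and
`Y + i Y'`, which are the images under `R` of elements of `ker (A + i)`. -/
lemma exists_mvfderiv_base_bracket_eq (h : IsLocalModelAt I φ A R Γ P z)
    {X X' Y Y' : ∀ y : N, TangentSpace I y}
    (hX : MDifferentiableAt I I.tangent (fun x => (⟨x, X x⟩ : TangentBundle I N)) z)
    (hX' : MDifferentiableAt I I.tangent (fun x => (⟨x, X' x⟩ : TangentBundle I N)) z)
    (hY : MDifferentiableAt I I.tangent (fun x => (⟨x, Y x⟩ : TangentBundle I N)) z)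
    (hY' : MDifferentiableAt I I.tangent (fun x => (⟨x, Y' x⟩ : TangentBundle I N)) z)
    {u v : N → Q} (hu : MDifferentiableAt I 𝓘(ℝ, Q) u z) (hv : MDifferentiableAt I 𝓘(ℝ, Q) v z)
    (hXu : ∀ᶠ y in 𝓝 z, mvfderiv I φ y (X y) = R y (u y))
    (hXu' : ∀ᶠ y in 𝓝 z, mvfderiv I φ y (X' y) = R y (A y • u y))
    (hYv : ∀ᶠ y in 𝓝 z, mvfderiv I φ y (Y y) = R y (v y))
    (hYv' : ∀ᶠ y in 𝓝 z, mvfderiv I φ y (Y' y) = R y (A y • v y))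
    (hXA : vertPart I φ A Γ P z (X' z) = A z * vertPart I φ A Γ P z (X z))
    (hYA : vertPart I φ A Γ P z (Y' z) = A z * vertPart I φ A Γ P z (Y z)) :
    ∃ w : Q,
      mvfderiv I φ z (VectorField.mlieBracket I X Y z - VectorField.mlieBracket I X' Y' z) =
        R z w ∧
      mvfderiv I φ z (VectorField.mlieBracket I X Y' z + VectorField.mlieBracket I X' Y z) =
        R z (A z • w) := by
  have hAu := mdifferentiableAt_smul_quaternion h.mdifferentiableAt_unit hu
  have hAv := mdifferentiableAt_smul_quaternion h.mdifferentiableAt_unit hv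
  have hA (q : Q) : A z • A z • q = -q := by
    rw [smul_smul, h.unit_mul_self, neg_smul, one_smul]
  -- With `ũ = u + i A u` and `ṽ = v + i A v`, this is the real part of `∇_{X + iX'} ṽ - ∇_{Y + iY'}
  -- ũ`.
  refine ⟨covDeriv I φ Γ v z (X z) - covDeriv I φ Γ u z (Y z) -
    (covDeriv I φ Γ (fun y => A y • v y) z (X' z) -
      covDeriv I φ Γ (fun y => A y • u y) z (Y' z)), ?_, ?_⟩
  · rw [map_sub, h.mvfderiv_base_mlieBracket hX hY hu hv hXu hYv,
      h.mvfderiv_base_mlieBracket hX' hY' hAu hAv hXu' hYv', ← map_sub]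
  · rw [map_add, h.mvfderiv_base_mlieBracket hX hY' hu hAv hXu hYv',
      h.mvfderiv_base_mlieBracket hX' hY hAu hv hXu' hYv, ← map_add]
    congr 1
    -- The terms containing derivatives of `A` agree on the two sides precisely because of `hXA`,
    -- `hYA` and `A² = -1`.
    simp only [h.covDeriv_unit_smul hu, h.covDeriv_unit_smul hv, hXA, hYA, smul_sub, smul_add,
      mul_smul, hA]
    abel

/-- The vertical components of the bracket of the complex vector fields `X + i X'` and
`Y + i Y'`. -/
lemma vertPart_bracket_eq (h : IsLocalModelAt I φ A R Γ P z)
    {X X' Y Y' : ∀ y : N, TangentSpace I y}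
    (hX : MDifferentiableAt I I.tangent (fun x => (⟨x, X x⟩ : TangentBundle I N)) z)
    (hX' : MDifferentiableAt I I.tangent (fun x => (⟨x, X' x⟩ : TangentBundle I N)) z)
    (hY : MDifferentiableAt I I.tangent (fun x => (⟨x, Y x⟩ : TangentBundle I N)) z)
    (hY' : MDifferentiableAt I I.tangent (fun x => (⟨x, Y' x⟩ : TangentBundle I N)) z)
    (hXA : ∀ᶠ y in 𝓝 z, vertPart I φ A Γ P y (X' y) = A y * vertPart I φ A Γ P y (X y))
    (hYA : ∀ᶠ y in 𝓝 z, vertPart I φ A Γ P y (Y' y) = A y * vertPart I φ A Γ P y (Y y))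
    {r r' : ℍ[ℝ]}
    (hr : curvPart I φ Γ P z (X z) (Y z) - curvPart I φ Γ P z (X' z) (Y' z) = r)
    (hr' : curvPart I φ Γ P z (X z) (Y' z) + curvPart I φ Γ P z (X' z) (Y z) = r')
    (hrr' : A z * (r * A z - A z * r) = r' * A z - A z * r') :
    vertPart I φ A Γ P z (VectorField.mlieBracket I X Y' z + VectorField.mlieBracket I X' Y z) =
      A z * vertPart I φ A Γ P z
        (VectorField.mlieBracket I X Y z - VectorField.mlieBracket I X' Y' z) := by
  have hadd (ξ η : TangentSpace I z) : vertPart I φ A Γ P z (ξ + η) =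
      vertPart I φ A Γ P z ξ + vertPart I φ A Γ P z η := by
    simp only [vertPart, formPart, map_add]
    noncomm_ring
  have hsub (ξ η : TangentSpace I z) : vertPart I φ A Γ P z (ξ - η) =
      vertPart I φ A Γ P z ξ - vertPart I φ A Γ P z η := by
    simp only [vertPart, formPart, map_sub]
    noncomm_ring
  have hcongr {f g : N → ℍ[ℝ]} (hfg : ∀ᶠ y in 𝓝 z, f y = g y) (ξ : TangentSpace I z) :
      covDerivQ I φ Γ P f z ξ = covDerivQ I φ Γ P g z ξ := by
    rw [covDerivQ, covDerivQ, Filter.EventuallyEq.mvfderiv_eq hfg, hfg.self_of_nhds]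
  have hA (q : ℍ[ℝ]) : A z * (A z * q) = -q := by
    rw [← mul_assoc, h.unit_mul_self, neg_mul, one_mul]
  have hdX := h.mdifferentiableAt_vertPart hX
  have hdY := h.mdifferentiableAt_vertPart hY
  rw [hadd, hsub, h.vertPart_mlieBracket hX hY, h.vertPart_mlieBracket hX hY',
    h.vertPart_mlieBracket hX' hY, h.vertPart_mlieBracket hX' hY']
  subst hr hr'
  simp only [hcongr hXA, hcongr hYA, h.covDerivQ_unit_mul hdX, h.covDerivQ_unit_mul hdY,
    hXA.self_of_nhds, hYA.self_of_nhds]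
  -- The derivative terms match through the Leibniz rule and `A² = -1`; what remains is the
  -- curvature relation `hrr'`.
  simp only [sub_mul, mul_sub, add_mul, mul_add, mul_assoc, hA] at hrr' ⊢
  refine sub_eq_zero.1 (Eq.trans ?_ (sub_eq_zero.2 hrr'))
  abel

end IsLocalModelAt

end LocalData

/-! ### Continuous linear maps built from values on a basis. -/

section Interpolation

variable {E : Type*} [NormedAddCommGroup E] [NormedSpace ℝ E]
  {H : Type*} [TopologicalSpace H] {I : ModelWithCorners ℝ E H}
  {N : Type*} [TopologicalSpace N] [ChartedSpace H N]
  {F G : Type*} [NormedAddCommGroup F] [NormedSpace ℝ F] [FiniteDimensional ℝ F]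
  [NormedAddCommGroup G] [NormedSpace ℝ G]

/-- The linear map which takes the same values as `g` on a basis. -/
def interpolate (g : F → G) : F →L[ℝ] G :=
  ∑ i, ContinuousLinearMap.smulRightL ℝ F G
    (LinearMap.toContinuousLinearMap ((Module.finBasis ℝ F).coord i)) (g (Module.finBasis ℝ F i))

lemma interpolate_linearMap (B : F →ₗ[ℝ] G) (v : F) : interpolate (fun w => B w) v = B v := by
  conv_rhs => rw [← (Module.finBasis ℝ F).sum_repr v, map_sum]
  simp [interpolate]

/-- `interpolate` depends linearly on finitely many values, so differentiability at each fixed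
vector suffices. No linearity of `f y` is needed, which suits local forms that are linear only over
the base set of a trivialization. -/
lemma mdifferentiableAt_interpolate {f : N → F → G} {z : N}
    (hf : ∀ v, MDifferentiableAt I 𝓘(ℝ, G) (fun y => f y v) z) :
    MDifferentiableAt I 𝓘(ℝ, F →L[ℝ] G) (fun y => interpolate (f y)) z := by
  have h (s : Finset (Fin (Module.finrank ℝ F))) : MDifferentiableAt I 𝓘(ℝ, F →L[ℝ] G) (fun y =>
      ∑ i ∈ s, ContinuousLinearMap.smulRightL ℝ F G (LinearMap.toContinuousLinearMap
        ((Module.finBasis ℝ F).coord i)) (f y (Module.finBasis ℝ F i))) z := by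
    classical
    induction s using Finset.induction_on with
    | empty => simpa using mdifferentiableAt_const
    | insert i s hi ih =>
      simp only [Finset.sum_insert hi]
      exact (mdifferentiableAt_clm_comp _ (hf _)).add ih
  exact h Finset.univ

end Interpolation

/-! ### Sections and connections in a trivialization. -/

section Frame

variable {EM : Type*} [NormedAddCommGroup EM] [NormedSpace ℝ EM]
  {M : Type*} [TopologicalSpace M] [ChartedSpace EM M]
  {F : Type*} [NormedAddCommGroup F] [NormedSpace ℝ F]
  {V : M → Type*} [TopologicalSpace (TotalSpace F V)]
  [∀ x, AddCommGroup (V x)] [∀ x, Module ℝ (V x)] [∀ x, TopologicalSpace (V x)]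
  [FiberBundle F V] [VectorBundle ℝ F V]

section Coordinates

variable (e : Trivialization F (π F V)) [MemTrivializationAtlas e]

/-- The coordinates of a section in a trivialization. -/
def frameCoord (s : ∀ x, V x) (y : M) : F := e.linearMapAt ℝ y (s y)

variable {e} in
lemma frameCoord_eventuallyEq {x : M} (hx : x ∈ e.baseSet) (s : ∀ x, V x) :
    frameCoord e s =ᶠ[𝓝 x] fun y => (e ⟨y, s y⟩).2 := by
  filter_upwards [e.open_baseSet.mem_nhds hx] with y hy
  rw [frameCoord, e.coe_linearMapAt_of_mem hy]

variable {e} in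
lemma frameCoord_symm_eventuallyEq {x : M} (hx : x ∈ e.baseSet) (q : F) :
    frameCoord e (fun y => e.symmₗ ℝ y q) =ᶠ[𝓝 x] fun _ => q := by
  filter_upwards [e.open_baseSet.mem_nhds hx] with y hy
  rw [frameCoord, e.linearMapAt_symmₗ hy]

variable [IsManifold 𝓘(ℝ, EM) ∞ M] [ContMDiffVectorBundle ∞ F V 𝓘(ℝ, EM)]

variable {e}

lemma contMDiffAt_frameCoord_iff {x : M} (hx : x ∈ e.baseSet) {s : ∀ x, V x} :
    ContMDiffAt 𝓘(ℝ, EM) 𝓘(ℝ, F) ∞ (frameCoord e s) x ↔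
      ContMDiffAt 𝓘(ℝ, EM) (𝓘(ℝ, EM).prod 𝓘(ℝ, F)) ∞ (fun y => TotalSpace.mk' F y (s y)) x := by
  rw [e.contMDiffAt_section_iff hx]
  exact (frameCoord_eventuallyEq hx s).contMDiffAt_iff

lemma mdifferentiableAt_frameCoord_iff {x : M} (hx : x ∈ e.baseSet) {s : ∀ x, V x} :
    MDifferentiableAt 𝓘(ℝ, EM) 𝓘(ℝ, F) (frameCoord e s) x ↔
      MDifferentiableAt 𝓘(ℝ, EM) (𝓘(ℝ, EM).prod 𝓘(ℝ, F)) (fun y => TotalSpace.mk' F y (s y)) x := by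
  have : ContMDiffVectorBundle 1 F V 𝓘(ℝ, EM) := .of_le (n := ∞) ENat.LEInfty.out
  rw [e.mdifferentiableAt_section_iff _ _ hx]
  exact (frameCoord_eventuallyEq hx s).mdifferentiableAt_iff

lemma contMDiffAt_symm_const {x : M} (hx : x ∈ e.baseSet) (q : F) :
    ContMDiffAt 𝓘(ℝ, EM) (𝓘(ℝ, EM).prod 𝓘(ℝ, F)) ∞
      (fun y => TotalSpace.mk' F y (e.symmₗ ℝ y q)) x :=
  (contMDiffAt_frameCoord_iff hx).1
    (contMDiffAt_const.congr_of_eventuallyEq (frameCoord_symm_eventuallyEq hx q))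

lemma mdifferentiableAt_symm_const {x : M} (hx : x ∈ e.baseSet) (q : F) :
    MDifferentiableAt 𝓘(ℝ, EM) (𝓘(ℝ, EM).prod 𝓘(ℝ, F))
      (fun y => TotalSpace.mk' F y (e.symmₗ ℝ y q)) x :=
  (contMDiffAt_symm_const hx q).mdifferentiableAt (by simp)

end Coordinates

variable [∀ x, IsTopologicalAddGroup (V x)] [∀ x, ContinuousSMul ℝ (V x)]

/-- The local connection form of `∇` in a trivialization. -/
def frameForm (nabla : CovariantDerivative 𝓘(ℝ, EM) F V)
    (e : Trivialization F (π F V)) [MemTrivializationAtlas e]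
    (x : M) (X : TangentSpace 𝓘(ℝ, EM) x) (q : F) : F :=
  e.linearMapAt ℝ x (nabla (fun y => e.symmₗ ℝ y q) x X)

/-- The flat connection of a trivialization. -/
def frameCov (e : Trivialization F (π F V)) [MemTrivializationAtlas e] (s : ∀ x, V x) (x : M) :
    TangentSpace 𝓘(ℝ, EM) x →L[ℝ] V x :=
  (e.symmL ℝ x).comp (mvfderiv 𝓘(ℝ, EM) (frameCoord e s) x)

variable [IsManifold 𝓘(ℝ, EM) ∞ M] [ContMDiffVectorBundle ∞ F V 𝓘(ℝ, EM)]

/-- The flat connection serves as reference: its difference from `∇` is a tensor, which yields the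
connection form. -/
lemma isCovariantDerivativeOn_frameCov (e : Trivialization F (π F V)) [MemTrivializationAtlas e] :
    IsCovariantDerivativeOn (I := 𝓘(ℝ, EM)) F (frameCov (EM := EM) (V := V) e) e.baseSet where
  add {s s' x} hs hs' hx := by
    have h1 := (mdifferentiableAt_frameCoord_iff hx).2 hs
    have h2 := (mdifferentiableAt_frameCoord_iff hx).2 hs'
    have h3 : frameCoord e (s + s') = frameCoord e s + frameCoord e s' := by
      ext y; simp [frameCoord]
    rw [frameCov, frameCov, frameCov, h3, mvfderiv_add h1 h2, ContinuousLinearMap.comp_add]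
  leibniz {s g x} hs hg hx := by
    have h1 := (mdifferentiableAt_frameCoord_iff hx).2 hs
    have h3 : frameCoord e (g • s) = g • frameCoord e s := by
      ext y; simp [frameCoord]
    rw [frameCov, frameCov, h3, mvfderiv_smul hg h1]
    ext X
    simp only [ContinuousLinearMap.comp_apply, add_apply, smul_apply, map_add, map_smul,
      ContinuousLinearMap.smulRight_apply]
    congr 2
    exact e.symmₗ_linearMapAt hx (s x)

variable [FiniteDimensional ℝ F]
  {nabla : CovariantDerivative 𝓘(ℝ, EM) F V} {e : Trivialization F (π F V)}
  [MemTrivializationAtlas e]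

/-- The covariant derivative in a trivialization. The connection form is bilinear. -/
lemma exists_bilin_frameForm {x : M} (hx : x ∈ e.baseSet) :
    ∃ D : V x →L[ℝ] TangentSpace 𝓘(ℝ, EM) x →L[ℝ] V x,
      (∀ (q : F) (X : TangentSpace 𝓘(ℝ, EM) x),
        frameForm nabla e x X q = e.linearMapAt ℝ x (D (e.symmₗ ℝ x q) X)) ∧
      ∀ s : ∀ x, V x, MDifferentiableAt 𝓘(ℝ, EM) (𝓘(ℝ, EM).prod 𝓘(ℝ, F))
        (fun y => TotalSpace.mk' F y (s y)) x → ∀ X : TangentSpace 𝓘(ℝ, EM) x,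
        e.linearMapAt ℝ x (nabla s x X) =
          mvfderiv 𝓘(ℝ, EM) (frameCoord e s) x X + frameForm nabla e x X (frameCoord e s x) := by
  have : ContMDiffVectorBundle 1 F V 𝓘(ℝ, EM) := .of_le (n := ∞) ENat.LEInfty.out
  have hc := nabla.isCovariantDerivativeOn (s := e.baseSet)
  have hf := isCovariantDerivativeOn_frameCov (EM := EM) e
  have key {s : ∀ x, V x} (hs : MDifferentiableAt 𝓘(ℝ, EM) (𝓘(ℝ, EM).prod 𝓘(ℝ, F))
        (fun y => TotalSpace.mk' F y (s y)) x) (X : TangentSpace 𝓘(ℝ, EM) x) :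
      e.linearMapAt ℝ x (nabla s x X) = mvfderiv 𝓘(ℝ, EM) (frameCoord e s) x X +
        e.linearMapAt ℝ x (IsCovariantDerivativeOn.difference hc hf x (s x) X) := by
    have h1 : e.linearMapAt ℝ x (frameCov e s x X) = mvfderiv 𝓘(ℝ, EM) (frameCoord e s) x X :=
      e.linearMapAt_symmₗ hx _
    rw [IsCovariantDerivativeOn.difference_apply hc hf hx hs, sub_apply, map_sub, h1]
    abel
  -- A section with constant coordinates is flat for the reference connection, so only the
  -- difference tensor contributes.
  have hq (q : F) (X : TangentSpace 𝓘(ℝ, EM) x) : frameForm nabla e x X q =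
      e.linearMapAt ℝ x (IsCovariantDerivativeOn.difference hc hf x (e.symmₗ ℝ x q) X) := by
    rw [frameForm, key (mdifferentiableAt_symm_const hx q),
      (frameCoord_symm_eventuallyEq hx q).mvfderiv_eq, mvfderiv_const]
    simp
  refine ⟨_, hq, fun s hs X => ?_⟩
  rw [key hs, hq, frameCoord, e.symmₗ_linearMapAt hx]

omit [FiniteDimensional ℝ F] in
/-- A smooth connection maps smooth local sections to smooth ones. -/
lemma mdifferentiableAt_nabla [FiniteDimensional ℝ EM] [T2Space M]
    [nabla.ContMDiffCovariantDerivative ∞] {U : Set M} (hU : IsOpen U) {x : M} (hx : x ∈ U)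
    {s : ∀ x, V x}
    (hs : ContMDiffOn 𝓘(ℝ, EM) (𝓘(ℝ, EM).prod 𝓘(ℝ, F)) ∞ (fun y => TotalSpace.mk' F y (s y)) U)
    {Y : ∀ x : M, TangentSpace 𝓘(ℝ, EM) x}
    (hY : MDifferentiableAt 𝓘(ℝ, EM) 𝓘(ℝ, EM).tangent
      (fun y => (⟨y, Y y⟩ : TangentBundle 𝓘(ℝ, EM) M)) x) :
    MDifferentiableAt 𝓘(ℝ, EM) (𝓘(ℝ, EM).prod 𝓘(ℝ, F))
      (fun y => TotalSpace.mk' F y (nabla s y (Y y))) x := by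
  have : ContMDiffVectorBundle 1 F V 𝓘(ℝ, EM) := .of_le (n := ∞) ENat.LEInfty.out
  -- Smoothness of `∇` is applied to global sections. Multiplication by a bump function extends `s`
  -- globally, and locality keeps its covariant derivative unchanged near `x`.
  obtain ⟨ψ, hψ⟩ := ((SmoothBumpFunction.nhds_basis_tsupport (I := 𝓘(ℝ, EM)) x).mem_iff).1
    (hU.mem_nhds hx)
  have hσ : ContMDiff 𝓘(ℝ, EM) (𝓘(ℝ, EM).prod 𝓘(ℝ, F)) ∞
      (fun y => TotalSpace.mk' F y (((ψ : M → ℝ) • s) y)) :=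
    ContMDiffOn.smul_section_of_tsupport ψ.contMDiff.contMDiffOn hU hψ.2 hs
  have hn := (CovariantDerivative.ContMDiffCovariantDerivative.contMDiff (cov := nabla)
    (k := ∞)).contMDiff (σ := (ψ : M → ℝ) • s) hσ.contMDiffOn
  have hn1 := (hn.contMDiffAt (x := x) Filter.univ_mem).mdifferentiableAt (by simp)
  refine (hn1.clm_bundle_apply hY).congr_of_eventuallyEq ?_
  filter_upwards [ψ.eventuallyEq_one.eventuallyEq_nhds, hU.mem_nhds hx] with y hy hyU
  have h1 : nabla s y = nabla ((ψ : M → ℝ) • s) y := by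
    refine nabla.isCovariantDerivativeOnUniv.congr_of_eventuallyEq
      (((hs y hyU).contMDiffAt (hU.mem_nhds hyU)).mdifferentiableAt (by simp))
      (hσ.contMDiffAt.mdifferentiableAt (by simp)) Filter.univ_mem ?_
    filter_upwards [hy] with w hw
    simp [hw]
  rw [h1]

/-- A smooth connection has a differentiable connection form in a trivialization. -/
lemma exists_connectionForm [FiniteDimensional ℝ EM] [T2Space M]
    [nabla.ContMDiffCovariantDerivative ∞] {x : M} (hx : x ∈ e.baseSet) :
    ∃ Γ : M → EM →L[ℝ] F →L[ℝ] F,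
      MDifferentiableAt 𝓘(ℝ, EM) 𝓘(ℝ, EM →L[ℝ] F →L[ℝ] F) Γ x ∧
      ∀ᶠ y in 𝓝 x, ∀ (X : TangentSpace 𝓘(ℝ, EM) y) (q : F), frameForm nabla e y X q =
        Γ y (mvfderiv 𝓘(ℝ, EM) (extChartAt 𝓘(ℝ, EM) x) y X) q := by
  let τ := trivializationAt EM (TangentSpace 𝓘(ℝ, EM) : M → Type _) x
  have hxτ : x ∈ τ.baseSet := FiberBundle.mem_baseSet_trivializationAt' x
  -- Tangent vectors are written in the trivialization of `TM` at `x`, so that `Γ` takes values in a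
  -- fixed space.
  refine ⟨fun y => interpolate fun v => interpolate fun q =>
    frameForm nabla e y (τ.symmₗ ℝ y v) q, ?_, ?_⟩
  · refine mdifferentiableAt_interpolate fun v => mdifferentiableAt_interpolate fun q => ?_
    refine (mdifferentiableAt_frameCoord_iff hx).2 (mdifferentiableAt_nabla e.open_baseSet hx
      (fun y hy => (contMDiffAt_symm_const hy q).contMDiffWithinAt) ?_)
    exact mdifferentiableAt_symm_const hxτ v
  · filter_upwards [e.open_baseSet.mem_nhds hx, chart_source_mem_nhds EM x] with y hy hyx X q
    obtain ⟨D, hD, -⟩ := exists_bilin_frameForm (nabla := nabla) hy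
    let B : EM →ₗ[ℝ] F →ₗ[ℝ] F := LinearMap.mk₂ ℝ
      (fun v q => e.linearMapAt ℝ y (D (e.symmₗ ℝ y q) (τ.symmₗ ℝ y v)))
      (by intros; simp) (by intros; simp) (by intros; simp) (by intros; simp)
    have h1 (v : EM) : (interpolate fun q => frameForm nabla e y (τ.symmₗ ℝ y v) q) =
        (LinearMap.toContinuousLinearMap.toLinearMap ∘ₗ B) v := by
      ext q
      simp only [hD]
      exact interpolate_linearMap (B v) q
    simp only [h1]
    rw [interpolate_linearMap]
    change _ = e.linearMapAt ℝ y (D (e.symmₗ ℝ y q) (τ.symmₗ ℝ y _))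
    rw [hD]
    congr 2
    -- That trivialization is the differential of the chart at `x`.
    have h2 := TangentBundle.continuousLinearMapAt_trivializationAt (I := 𝓘(ℝ, EM)) hyx
    have h3 : mvfderiv 𝓘(ℝ, EM) (extChartAt 𝓘(ℝ, EM) x) y X = τ.linearMapAt ℝ y X :=
      (congrArg (fun L => L X) h2).symm
    rw [h3, τ.symmₗ_linearMapAt hyx]

end Frame

/-! ### The anchor `ρ`, torsion and curvature in a trivialization. -/

section Anchor

variable {EM : Type*} [NormedAddCommGroup EM] [NormedSpace ℝ EM]
  {M : Type*} [TopologicalSpace M] [ChartedSpace EM M] [IsManifold 𝓘(ℝ, EM) ∞ M]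
  {F : Type*} [NormedAddCommGroup F] [NormedSpace ℝ F] [FiniteDimensional ℝ F]
  {V : M → Type*} [TopologicalSpace (TotalSpace F V)]
  [∀ x, AddCommGroup (V x)] [∀ x, Module ℝ (V x)] [∀ x, TopologicalSpace (V x)]
  [FiberBundle F V] [VectorBundle ℝ F V] [ContMDiffVectorBundle ∞ F V 𝓘(ℝ, EM)]
  {ρ : ∀ x : M, V x →ₗ[ℝ] TangentSpace 𝓘(ℝ, EM) x}
  {e : Trivialization F (π F V)} [MemTrivializationAtlas e]
  {G : Type*} [NormedAddCommGroup G] [NormedSpace ℝ G]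

omit [FiniteDimensional ℝ F] in
lemma mdifferentiableAt_anchor_symm
    (hρ : ContMDiff (𝓘(ℝ, EM).prod 𝓘(ℝ, F)) (𝓘(ℝ, EM).prod 𝓘(ℝ, EM)) ∞
      (fun v : TotalSpace F V => (⟨v.1, ρ v.1 v.2⟩ : TangentBundle 𝓘(ℝ, EM) M)))
    {x : M} (hx : x ∈ e.baseSet) (q : F) :
    MDifferentiableAt 𝓘(ℝ, EM) 𝓘(ℝ, EM).tangent
      (fun y => (⟨y, ρ y (e.symmₗ ℝ y q)⟩ : TangentBundle 𝓘(ℝ, EM) M)) x :=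
  (hρ.contMDiffAt.comp x (contMDiffAt_symm_const hx q)).mdifferentiableAt (by simp)

omit [ContMDiffVectorBundle ∞ F V 𝓘(ℝ, EM)] [IsManifold 𝓘(ℝ, EM) ∞ M] in
variable (ρ e) in
/-- The morphism `ρ` in a trivialization, composed with the differential of `φ`. -/
def anchorForm (φ : M → G) (y : M) : F →L[ℝ] G :=
  interpolate fun q => mvfderiv 𝓘(ℝ, EM) φ y (ρ y (e.symmₗ ℝ y q))

omit [ContMDiffVectorBundle ∞ F V 𝓘(ℝ, EM)] [IsManifold 𝓘(ℝ, EM) ∞ M] in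
lemma anchorForm_apply (φ : M → G) (y : M) (q : F) :
    anchorForm ρ e φ y q = mvfderiv 𝓘(ℝ, EM) φ y (ρ y (e.symmₗ ℝ y q)) :=
  interpolate_linearMap
    ((mvfderiv 𝓘(ℝ, EM) φ y).toLinearMap ∘ₗ (ρ y) ∘ₗ (e.symmₗ ℝ y)) q

variable [CompleteSpace EM]

lemma mdifferentiableAt_anchorForm
    (hρ : ContMDiff (𝓘(ℝ, EM).prod 𝓘(ℝ, F)) (𝓘(ℝ, EM).prod 𝓘(ℝ, EM)) ∞
      (fun v : TotalSpace F V => (⟨v.1, ρ v.1 v.2⟩ : TangentBundle 𝓘(ℝ, EM) M)))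
    {x : M} (hx : x ∈ e.baseSet) {φ : M → G} (hφ : ContMDiffAt 𝓘(ℝ, EM) 𝓘(ℝ, G) ∞ φ x) :
    MDifferentiableAt 𝓘(ℝ, EM) 𝓘(ℝ, F →L[ℝ] G) (anchorForm ρ e φ) x :=
  mdifferentiableAt_interpolate fun q =>
    mdifferentiableAt_mvfderiv_apply hφ (mdifferentiableAt_anchor_symm hρ hx q)

variable [∀ x, IsTopologicalAddGroup (V x)] [∀ x, ContinuousSMul ℝ (V x)]
  {nabla : CovariantDerivative 𝓘(ℝ, EM) F V}

/-- The absence of torsion in a trivialization. -/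
lemma anchorForm_connectionForm
    (hρ : ContMDiff (𝓘(ℝ, EM).prod 𝓘(ℝ, F)) (𝓘(ℝ, EM).prod 𝓘(ℝ, EM)) ∞
      (fun v : TotalSpace F V => (⟨v.1, ρ v.1 v.2⟩ : TangentBundle 𝓘(ℝ, EM) M)))
    {x : M} (hx : x ∈ e.baseSet) {φ : M → G} (hφ : ContMDiffAt 𝓘(ℝ, EM) 𝓘(ℝ, G) ∞ φ x)
    {Γ : G →L[ℝ] F →L[ℝ] F} (hΓ : ∀ (X : TangentSpace 𝓘(ℝ, EM) x) (q : F),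
      frameForm nabla e x X q = Γ (mvfderiv 𝓘(ℝ, EM) φ x X) q)
    {q q' : F}
    (ht : ρ x (nabla (fun y => e.symmₗ ℝ y q') x (ρ x (e.symmₗ ℝ x q))
        - nabla (fun y => e.symmₗ ℝ y q) x (ρ x (e.symmₗ ℝ x q')))
        - VectorField.mlieBracket 𝓘(ℝ, EM) (fun y => ρ y (e.symmₗ ℝ y q))
          (fun y => ρ y (e.symmₗ ℝ y q')) x = 0) :
    anchorForm ρ e φ x (Γ (mvfderiv 𝓘(ℝ, EM) φ x (ρ x (e.symmₗ ℝ x q))) q' -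
        Γ (mvfderiv 𝓘(ℝ, EM) φ x (ρ x (e.symmₗ ℝ x q'))) q) =
      mvfderiv 𝓘(ℝ, EM) (anchorForm ρ e φ) x (ρ x (e.symmₗ ℝ x q)) q' -
        mvfderiv 𝓘(ℝ, EM) (anchorForm ρ e φ) x (ρ x (e.symmₗ ℝ x q')) q := by
  have hR := mdifferentiableAt_anchorForm hρ hx hφ
  have key (q : F) (ξ : TangentSpace 𝓘(ℝ, EM) x) :
      mvfderiv 𝓘(ℝ, EM) (fun y => mvfderiv 𝓘(ℝ, EM) φ y (ρ y (e.symmₗ ℝ y q))) x ξ =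
        mvfderiv 𝓘(ℝ, EM) (anchorForm ρ e φ) x ξ q := by
    simp only [← anchorForm_apply]
    rw [mvfderiv_clm_apply hR mdifferentiableAt_const, mvfderiv_const]
    simp
  rw [← hΓ, ← hΓ, frameForm, frameForm, ← map_sub, anchorForm_apply, e.symmₗ_linearMapAt hx,
    sub_eq_zero.1 ht, mvfderiv_apply_mlieBracket hφ (mdifferentiableAt_anchor_symm hρ hx q)
      (mdifferentiableAt_anchor_symm hρ hx q'), key, key]

/-- The curvature form in a trivialization. -/
lemma linearMapAt_curvatureOfFields [FiniteDimensional ℝ EM] [T2Space M]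
    [nabla.ContMDiffCovariantDerivative ∞]
    {x : M} (hx : x ∈ e.baseSet) {φ : M → G} (hφ : ContMDiffAt 𝓘(ℝ, EM) 𝓘(ℝ, G) ∞ φ x)
    {Γ : M → G →L[ℝ] F →L[ℝ] F} (hΓ' : MDifferentiableAt 𝓘(ℝ, EM) 𝓘(ℝ, G →L[ℝ] F →L[ℝ] F) Γ x)
    (hΓ : ∀ᶠ y in 𝓝 x, ∀ (X : TangentSpace 𝓘(ℝ, EM) y) (q : F),
      frameForm nabla e y X q = Γ y (mvfderiv 𝓘(ℝ, EM) φ y X) q)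
    {s : ∀ x, V x} {U : Set M} (hU : IsOpen U) (hxU : x ∈ U)
    (hs : ContMDiffOn 𝓘(ℝ, EM) (𝓘(ℝ, EM).prod 𝓘(ℝ, F)) ∞ (fun y => TotalSpace.mk' F y (s y)) U)
    {X Y : ∀ x : M, TangentSpace 𝓘(ℝ, EM) x}
    (hX : MDifferentiableAt 𝓘(ℝ, EM) 𝓘(ℝ, EM).tangent
      (fun y => (⟨y, X y⟩ : TangentBundle 𝓘(ℝ, EM) M)) x)
    (hY : MDifferentiableAt 𝓘(ℝ, EM) 𝓘(ℝ, EM).tangent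
      (fun y => (⟨y, Y y⟩ : TangentBundle 𝓘(ℝ, EM) M)) x) :
    e.linearMapAt ℝ x (nabla (fun y => nabla s y (Y y)) x (X x)
        - nabla (fun y => nabla s y (X y)) x (Y x)
        - nabla s x (VectorField.mlieBracket 𝓘(ℝ, EM) X Y x)) =
      (mvfderiv 𝓘(ℝ, EM) Γ x (X x) (mvfderiv 𝓘(ℝ, EM) φ x (Y x)) -
        mvfderiv 𝓘(ℝ, EM) Γ x (Y x) (mvfderiv 𝓘(ℝ, EM) φ x (X x))) (e.linearMapAt ℝ x (s x)) +
      (Γ x (mvfderiv 𝓘(ℝ, EM) φ x (X x)) (Γ x (mvfderiv 𝓘(ℝ, EM) φ x (Y x))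
          (e.linearMapAt ℝ x (s x))) -
        Γ x (mvfderiv 𝓘(ℝ, EM) φ x (Y x)) (Γ x (mvfderiv 𝓘(ℝ, EM) φ x (X x))
          (e.linearMapAt ℝ x (s x)))) := by
  have hsd {y : M} (hy : y ∈ U) := (hs y hy).contMDiffAt (hU.mem_nhds hy)
  have hf : ContMDiffAt 𝓘(ℝ, EM) 𝓘(ℝ, F) ∞ (frameCoord e s) x :=
    (contMDiffAt_frameCoord_iff hx).2 (hsd hxU)
  have hfd : MDifferentiableAt 𝓘(ℝ, EM) 𝓘(ℝ, F) (frameCoord e s) x :=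
    hf.mdifferentiableAt (by simp)
  have first {y : M} (hy : y ∈ e.baseSet) {s : ∀ x, V x}
      (hs : MDifferentiableAt 𝓘(ℝ, EM) (𝓘(ℝ, EM).prod 𝓘(ℝ, F))
        (fun y => TotalSpace.mk' F y (s y)) y) (Z : TangentSpace 𝓘(ℝ, EM) y) :
      e.linearMapAt ℝ y (nabla s y Z) =
        mvfderiv 𝓘(ℝ, EM) (frameCoord e s) y Z + frameForm nabla e y Z (frameCoord e s y) := by
    obtain ⟨D, -, hD⟩ := exists_bilin_frameForm (nabla := nabla) hy
    exact hD s hs Z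
  have second {X Y : ∀ x : M, TangentSpace 𝓘(ℝ, EM) x}
      (hY : MDifferentiableAt 𝓘(ℝ, EM) 𝓘(ℝ, EM).tangent
        (fun y => (⟨y, Y y⟩ : TangentBundle 𝓘(ℝ, EM) M)) x) :
      e.linearMapAt ℝ x (nabla (fun y => nabla s y (Y y)) x (X x)) =
        mvfderiv 𝓘(ℝ, EM) (fun y => mvfderiv 𝓘(ℝ, EM) (frameCoord e s) y (Y y)) x (X x) +
        (mvfderiv 𝓘(ℝ, EM) Γ x (X x) (mvfderiv 𝓘(ℝ, EM) φ x (Y x)) (frameCoord e s x) +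
          Γ x (mvfderiv 𝓘(ℝ, EM) (fun y => mvfderiv 𝓘(ℝ, EM) φ y (Y y)) x (X x))
            (frameCoord e s x) +
          Γ x (mvfderiv 𝓘(ℝ, EM) φ x (Y x)) (mvfderiv 𝓘(ℝ, EM) (frameCoord e s) x (X x))) +
        (Γ x (mvfderiv 𝓘(ℝ, EM) φ x (X x)) (mvfderiv 𝓘(ℝ, EM) (frameCoord e s) x (Y x)) +
          Γ x (mvfderiv 𝓘(ℝ, EM) φ x (X x)) (Γ x (mvfderiv 𝓘(ℝ, EM) φ x (Y x))
            (frameCoord e s x))) := by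
    -- The first-order formula is needed on a neighbourhood, since it is differentiated again. In
    -- the final difference the second derivatives of the coordinates and of `φ` cancel against the
    -- bracket term, and the mixed first-order terms cancel by symmetry.
    have hev : frameCoord e (fun y => nabla s y (Y y)) =ᶠ[𝓝 x] fun y =>
        mvfderiv 𝓘(ℝ, EM) (frameCoord e s) y (Y y) +
          Γ y (mvfderiv 𝓘(ℝ, EM) φ y (Y y)) (frameCoord e s y) := by
      filter_upwards [hΓ, e.open_baseSet.mem_nhds hx, hU.mem_nhds hxU] with y hy hye hyU
      rw [← hy]
      exact first hye ((hsd hyU).mdifferentiableAt (by simp)) (Y y)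
    have hdY := mdifferentiableAt_mvfderiv_apply hφ hY
    rw [first hx (mdifferentiableAt_nabla hU hxU hs hY), hev.mvfderiv_eq, hΓ.self_of_nhds,
      hev.self_of_nhds]
    have e2 := mvfderiv_add (mdifferentiableAt_mvfderiv_apply hf hY)
      ((hΓ'.clm_apply hdY).clm_apply hfd)
    have e3 : mvfderiv 𝓘(ℝ, EM) (fun y => mvfderiv 𝓘(ℝ, EM) (frameCoord e s) y (Y y) +
          Γ y (mvfderiv 𝓘(ℝ, EM) φ y (Y y)) (frameCoord e s y)) x (X x) = _ :=
      congrArg (fun L => L (X x)) e2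
    rw [e3, add_apply, mvfderiv_clm_apply (hΓ'.clm_apply hdY) hfd,
      mvfderiv_clm_apply hΓ' hdY, map_add]
    rfl
  have hb : Γ x (mvfderiv 𝓘(ℝ, EM) φ x (VectorField.mlieBracket 𝓘(ℝ, EM) X Y x)) = _ :=
    congrArg (Γ x) (mvfderiv_apply_mlieBracket hφ hX hY)
  rw [map_sub, map_sub, second hX, second hY,
    first hx ((hsd hxU).mdifferentiableAt (by simp)), hΓ.self_of_nhds,
    mvfderiv_apply_mlieBracket hf hX hY, hb]
  simp only [map_sub, sub_apply, frameCoord]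
  abel

end Anchor

/-! ### Quaternionic endomorphisms and the algebra of the Bianchi identity. -/

section QuaternionicForms

variable {E : Type*} [NormedAddCommGroup E] [NormedSpace ℝ E]
  {H : Type*} [TopologicalSpace H] {I : ModelWithCorners ℝ E H}
  {N : Type*} [TopologicalSpace N] [ChartedSpace H N]
  {F : Type*} [NormedAddCommGroup F] [NormedSpace ℝ F]
  {Q : Type*} [NormedAddCommGroup Q] [NormedSpace ℝ Q] [Module ℍ[ℝ] Q] [IsBoundedSMul ℍ[ℝ] Q]
  [IsScalarTower ℝ ℍ[ℝ] Q] {P : (Q →L[ℝ] Q) →L[ℝ] ℍ[ℝ]}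

variable (P) in
/-- The endomorphism `G`, up to left multiplication by its component `P G`, commutes with left
multiplications. -/
def IsQuaternionicEnd (G : Q →L[ℝ] Q) : Prop :=
  ∀ (c : ℍ[ℝ]) (q : Q), G (c • q) - P G • c • q = c • (G q - P G • q)

lemma IsQuaternionicEnd.sub {G G' : Q →L[ℝ] Q} (h : IsQuaternionicEnd P G)
    (h' : IsQuaternionicEnd P G') : IsQuaternionicEnd P (G - G') := by
  intro c q
  have h1 := congrArg₂ (· - ·) (h c q) (h' c q)
  simp only [sub_apply, map_sub, sub_smul, smul_sub] at h1 ⊢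
  rw [← sub_eq_zero] at h1 ⊢
  rw [← h1]
  abel

/-- The commutator of two endomorphisms of `ℍᵏ` which commute with left multiplications, up to
their components `P G` and `P G'`. -/
lemma IsQuaternionicEnd.commutator {G G' : Q →L[ℝ] Q} (h : IsQuaternionicEnd P G)
    (h' : IsQuaternionicEnd P G') (c : ℍ[ℝ]) (q : Q) :
    (G (G' (c • q)) - G' (G (c • q))) - (P G * P G' - P G' * P G) • c • q =
      c • ((G (G' q) - G' (G q)) - (P G * P G' - P G' * P G) • q) := by
  set p := P G
  set p' := P G'
  -- With `G = p + S`, `G' = p' + S'` and `S, S'` `ℍ`-linear, the cross terms vanish and the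
  -- commutator is `[p, p'] + [S, S']`.
  obtain ⟨S, hS, hc⟩ : ∃ S : Q →L[ℝ] Q, (∀ q, G q = p • q + S q) ∧ ∀ (c : ℍ[ℝ]) q,
      S (c • q) = c • S q :=
    ⟨G - ContinuousLinearMap.lsmul ℝ ℍ[ℝ] p, by simp, fun c q => by simpa using h c q⟩
  obtain ⟨S', hS', hc'⟩ : ∃ S : Q →L[ℝ] Q, (∀ q, G' q = p' • q + S q) ∧ ∀ (c : ℍ[ℝ]) q,
      S (c • q) = c • S q :=
    ⟨G' - ContinuousLinearMap.lsmul ℝ ℍ[ℝ] p', by simp, fun c q => by simpa using h' c q⟩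
  simp only [hS, hS', map_add, hc, hc', smul_add, smul_sub, sub_smul, mul_smul]
  abel

/-- The derivative of a form with values in the endomorphisms which commute with left
multiplications up to their component. -/
lemma isQuaternionicEnd_mvfderiv {Γ : N → F →L[ℝ] Q →L[ℝ] Q} {z : N}
    (hΓ : MDifferentiableAt I 𝓘(ℝ, F →L[ℝ] Q →L[ℝ] Q) Γ z)
    (h : ∀ᶠ y in 𝓝 z, ∀ v, IsQuaternionicEnd P (Γ y v)) (ξ : TangentSpace I z) (v : F) :
    IsQuaternionicEnd P (mvfderiv I Γ z ξ v) := by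
  intro c q
  let Λ := ContinuousLinearMap.lsmul ℝ ℍ[ℝ] (E := Q)
  -- For fixed `c` and `q` the condition on `G` is `D G = 0` with `D` linear and continuous, so it
  -- passes to derivatives.
  let D : (Q →L[ℝ] Q) →L[ℝ] Q :=
    (ContinuousLinearMap.apply ℝ Q (c • q) - Λ.flip (c • q) ∘L P) -
      Λ c ∘L (ContinuousLinearMap.apply ℝ Q q - Λ.flip q ∘L P)
  have hv := hΓ.clm_apply (mdifferentiableAt_const (c := v))
  have h1 : (fun y => D (Γ y v)) =ᶠ[𝓝 z] fun _ => 0 := by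
    filter_upwards [h] with y hy
    exact sub_eq_zero.2 (hy v c q)
  have h2 := mvfderiv_clm_comp D hv ξ
  rw [h1.mvfderiv_eq, mvfderiv_const, mvfderiv_clm_apply hΓ mdifferentiableAt_const,
    mvfderiv_const] at h2
  simp only [zero_apply, map_zero, add_zero] at h2
  exact sub_eq_zero.1 h2.symm

/-- The curvature form, up to its component, commutes with left multiplications. -/
lemma curvPart_spec {φ : N → F} {Γ : N → F →L[ℝ] Q →L[ℝ] Q} {z : N}
    (hΓ : MDifferentiableAt I 𝓘(ℝ, F →L[ℝ] Q →L[ℝ] Q) Γ z)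
    (h : ∀ᶠ y in 𝓝 z, ∀ v, IsQuaternionicEnd P (Γ y v)) (ξ η : TangentSpace I z) :
    ∃ S : Q → Q, (∀ (c : ℍ[ℝ]) q, S (c • q) = c • S q) ∧ ∀ q,
      (mvfderiv I Γ z ξ (mvfderiv I φ z η) - mvfderiv I Γ z η (mvfderiv I φ z ξ)) q +
        (Γ z (mvfderiv I φ z ξ) (Γ z (mvfderiv I φ z η) q) -
          Γ z (mvfderiv I φ z η) (Γ z (mvfderiv I φ z ξ) q)) =
      curvPart I φ Γ P z ξ η • q + S q := by
  have h1 := (isQuaternionicEnd_mvfderiv hΓ h ξ (mvfderiv I φ z η)).sub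
    (isQuaternionicEnd_mvfderiv hΓ h η (mvfderiv I φ z ξ))
  have h2 := (h.self_of_nhds (mvfderiv I φ z ξ)).commutator
    (h.self_of_nhds (mvfderiv I φ z η))
  refine ⟨fun q => _ - curvPart I φ Γ P z ξ η • q, fun c q => ?_, fun q => by
    rw [add_sub_cancel]⟩
  have h3 := congrArg₂ (· + ·) (h1 c q) (h2 c q)
  simp only [smul_add, smul_sub, sub_apply, map_sub, sub_smul, add_smul, curvPart,
    formPart] at h3 ⊢
  rw [← sub_eq_zero] at h3 ⊢
  rw [← h3]
  abel

/-- The algebraic consequence of the first Bianchi identity. -/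
lemma commutator_eq_of_bianchi {a : ℍ[ℝ]} (ha : a * a = -1)
    (hQ : ∀ m : Q → Q → ℍ[ℝ], (∀ u v, m u v * a = -(a * m u v)) →
      (∀ u v w, m u v • w + m v w • u + m w u • v = 0) → ∀ u v, m u v = 0)
    {r r' : Q → Q → ℍ[ℝ]} {S S' : Q → Q → Q → Q}
    (hS : ∀ u v (c : ℍ[ℝ]) q, S u v (c • q) = c • S u v q)
    (hS' : ∀ u v (c : ℍ[ℝ]) q, S' u v (c • q) = c • S' u v q)
    (h : ∀ u v w,
      ((r u v • w + S u v w) - (r' u v • a • w + S' u v (a • w))) +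
      ((r v w • u + S v w u) - (r' v w • a • u + S' v w (a • u))) +
      ((r w u • v + S w u v) - (r' w u • a • v + S' w u (a • v))) = 0)
    (h' : ∀ u v w,
      ((r u v • a • w + S u v (a • w)) + (r' u v • w + S' u v w)) +
      ((r v w • a • u + S v w (a • u)) + (r' v w • u + S' v w u)) +
      ((r w u • a • v + S w u (a • v)) + (r' w u • v + S' w u v)) = 0) (u v : Q) :
    a * (r u v * a - a * r u v) = r' u v * a - a * r' u v := by
  -- A pair lies in `ker (J + i)` when `a` times its real part equals its imaginary part. This `m`
  -- is the coefficient left in that difference, for the Bianchi sum, once the `ℍ`-linear terms `S,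
  -- S'` cancel.
  have hz := hQ (fun u v => a * r u v - a * r' u v * a - r u v * a - r' u v) ?_ ?_ u v
  · have h1 : r u v * a - a * r u v = -(a * r' u v * a + r' u v) := by
      rw [← sub_eq_zero, ← neg_eq_zero, ← hz]; noncomm_ring
    rw [h1, mul_neg, mul_add, ← mul_assoc, ← mul_assoc, ha]
    noncomm_ring
  · intro u v
    have ha' (x : ℍ[ℝ]) : x * a * a = -x := by rw [mul_assoc, ha, mul_neg, mul_one]
    have ha'' (x : ℍ[ℝ]) : a * (a * x) = -x := by rw [← mul_assoc, ha, neg_mul, one_mul]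
    simp only [sub_mul, mul_sub, ha', ha'', mul_assoc a]
    simp only [← mul_assoc]
    noncomm_ring
  · intro u v w
    have haa (q : Q) : a • a • q = -q := by rw [smul_smul, ha, neg_smul, one_smul]
    have h1 := congrArg (fun q => a • q) (h u v w)
    have h2 := h' u v w
    simp only [hS, hS', smul_add, smul_sub, smul_zero, haa] at h1 h2
    have h3 := sub_eq_zero.2 (h1.trans h2.symm)
    simp only [sub_smul, mul_smul]
    rw [← h3]
    abel

end QuaternionicForms

/-! ### Differentiable solutions of linear systems. -/

section Solve

variable {E : Type*} [NormedAddCommGroup E] [NormedSpace ℝ E]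
  {H : Type*} [TopologicalSpace H] {I : ModelWithCorners ℝ E H}
  {N : Type*} [TopologicalSpace N] [ChartedSpace H N]
  {G : Type*} [NormedAddCommGroup G] [NormedSpace ℝ G] [FiniteDimensional ℝ G]
  {Q : Type*} [NormedAddCommGroup Q] [NormedSpace ℝ Q] [FiniteDimensional ℝ Q]

/-- The solution of an injective linear system with differentiable coefficients is
differentiable. -/
lemma mdifferentiableAt_of_clm_apply_eq {T : N → Q →L[ℝ] G} {g : N → G} {u : N → Q} {z : N}
    (hT : MDifferentiableAt I 𝓘(ℝ, Q →L[ℝ] G) T z) (hg : MDifferentiableAt I 𝓘(ℝ, G) g z)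
    (hinj : Function.Injective (T z)) (h : ∀ᶠ y in 𝓝 z, T y (u y) = g y) :
    MDifferentiableAt I 𝓘(ℝ, Q) u z := by
  have : CompleteSpace Q := FiniteDimensional.complete ℝ Q
  obtain ⟨L, hL⟩ := LinearMap.exists_leftInverse_of_injective (T z).toLinearMap
    (LinearMap.ker_eq_bot.2 hinj)
  let L' : G →L[ℝ] Q := L.toContinuousLinearMap
  -- At `z` this is the identity, so it stays invertible nearby, where `u = B⁻¹ (L' g)`.
  let B : N → Q →L[ℝ] Q := fun y => L' ∘L T y
  have hB : MDifferentiableAt I 𝓘(ℝ, Q →L[ℝ] Q) B z := mdifferentiableAt_const.clm_comp hT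
  have hBz : B z = 1 := by
    ext q
    exact LinearMap.congr_fun hL q
  have hu : IsUnit (B z) := hBz ▸ isUnit_one
  have hinv : MDifferentiableAt I 𝓘(ℝ, Q →L[ℝ] Q) (fun y => Ring.inverse (B y)) z :=
    (differentiableAt_inverse (𝕜 := ℝ) hu).mdifferentiableAt.comp z hB
  refine (hinv.clm_apply (mdifferentiableAt_clm_comp L' hg)).congr_of_eventuallyEq ?_
  filter_upwards [h, hB.continuousAt.preimage_mem_nhds (Units.isOpen.mem_nhds hu)] with y hy hyu
  have h1 : L' (g y) = B y (u y) := by rw [← hy]; rfl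
  have h2 := Ring.inverse_mul_cancel (B y) hyu
  rw [h1, ← mul_apply_eq_comp, h2, one_apply_eq_self]

end Solve

/-! ### Calculus on the product `M × S2`. -/

section Total

instance finrank_euclideanSpace_three :
    Fact (Module.finrank ℝ (EuclideanSpace ℝ (Fin 3)) = 2 + 1) :=
  ⟨finrank_euclideanSpace_fin⟩

variable {EM : Type*} [NormedAddCommGroup EM] [NormedSpace ℝ EM]
  {M : Type*} [TopologicalSpace M] [ChartedSpace EM M]
  {G : Type*} [NormedAddCommGroup G] [NormedSpace ℝ G]

lemma mdifferentiableAt_comp_fst {f : M → G} {z : M × S2}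
    (hf : MDifferentiableAt 𝓘(ℝ, EM) 𝓘(ℝ, G) f z.1) :
    MDifferentiableAt (𝓘(ℝ, EM).prod (𝓡 2)) 𝓘(ℝ, G) (fun z : M × S2 => f z.1) z :=
  hf.comp z mdifferentiableAt_fst

lemma mvfderiv_comp_fst {f : M → G} {z : M × S2}
    (hf : MDifferentiableAt 𝓘(ℝ, EM) 𝓘(ℝ, G) f z.1) (ξ : TZ (EM := EM) z) :
    mvfderiv (𝓘(ℝ, EM).prod (𝓡 2)) (fun z : M × S2 => f z.1) z ξ =
      mvfderiv 𝓘(ℝ, EM) f z.1 (dπ z ξ) :=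
  congrArg (fun L => L ξ) (mfderiv_comp z hf mdifferentiableAt_fst)

variable (EM M) in
lemma contMDiff_imQ_snd : ContMDiff (𝓘(ℝ, EM).prod (𝓡 2)) 𝓘(ℝ, ℍ[ℝ]) ∞
    (fun z : M × S2 => imQ z.2) :=
  imQL.contDiff.contMDiff.comp
    ((contMDiff_coe_sphere (E := EuclideanSpace ℝ (Fin 3)) (n := 2)).comp contMDiff_snd)

lemma mvfderiv_imQ_snd (z : M × S2) (ξ : TZ (EM := EM) z) :
    mvfderiv (𝓘(ℝ, EM).prod (𝓡 2)) (fun z : M × S2 => imQ z.2) z ξ = dS z ξ :=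
  mvfderiv_clm_comp imQL (f := fun z : M × S2 => (z.2 : EuclideanSpace ℝ (Fin 3)))
    (((contMDiff_coe_sphere (E := EuclideanSpace ℝ (Fin 3)) (n := 2) (m := ∞)).comp
      contMDiff_snd).mdifferentiableAt (by simp)) ξ

lemma mvfderiv_extChartAt_bijective [IsManifold 𝓘(ℝ, EM) ∞ M] {x y : M}
    (hy : y ∈ (chartAt EM x).source) :
    Function.Bijective (mvfderiv 𝓘(ℝ, EM) (extChartAt 𝓘(ℝ, EM) x) y) := by
  let τ := trivializationAt EM (TangentSpace 𝓘(ℝ, EM) : M → Type _) x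
  have hyτ : y ∈ τ.baseSet := hy
  have h2 := TangentBundle.continuousLinearMapAt_trivializationAt (I := 𝓘(ℝ, EM)) hy
  have h3 : (mvfderiv 𝓘(ℝ, EM) (extChartAt 𝓘(ℝ, EM) x) y : _ → EM) = τ.linearMapAt ℝ y :=
    funext fun X => (congrArg (fun L => L X) h2).symm
  rw [h3]
  exact ⟨Function.LeftInverse.injective (τ.symmₗ_linearMapAt hyτ),
    Function.RightInverse.surjective (τ.linearMapAt_symmₗ hyτ)⟩

end Total

/-! ### Involutivity of the distribution in a trivialization. -/

section Bracket

variable {EM : Type*} [NormedAddCommGroup EM] [NormedSpace ℝ EM]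
  {M : Type*} [TopologicalSpace M] [ChartedSpace EM M]
  {Q : Type*} [NormedAddCommGroup Q] [NormedSpace ℝ Q] [FiniteDimensional ℝ Q]
  [Module ℍ[ℝ] Q]
  {V : M → Type*} [TopologicalSpace (TotalSpace Q V)]
  [∀ x, AddCommGroup (V x)] [∀ x, Module ℝ (V x)] [∀ x, TopologicalSpace (V x)]
  [FiberBundle Q V] [VectorBundle ℝ Q V]
  [∀ x, IsTopologicalAddGroup (V x)] [∀ x, ContinuousSMul ℝ (V x)]
  (P : (Q →L[ℝ] Q) →L[ℝ] ℍ[ℝ])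
  (ρ : ∀ x : M, V x →ₗ[ℝ] TangentSpace 𝓘(ℝ, EM) x)
  (nabla : CovariantDerivative 𝓘(ℝ, EM) Q V)
  (e : Trivialization Q (π Q V)) [MemTrivializationAtlas e]

/-- The `ℍ`-component of the local connection form. -/
def formComp (x : M) (X : TangentSpace 𝓘(ℝ, EM) x) : ℍ[ℝ] :=
  P (interpolate (frameForm nabla e x X))

/-- The vertical component of a vector tangent to `M × S2`. -/
def vertComp (z : M × S2) (ξ : TZ (EM := EM) z) : ℍ[ℝ] :=
  dS z ξ + (formComp P nabla e z.1 (dπ z ξ) * imQ z.2 - imQ z.2 * formComp P nabla e z.1 (dπ z ξ))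

/-- The vector `ζ + i ζ'` is in the distribution `𝒞`, in a trivialization. -/
def IsInFrameC (z : M × S2) (ζ ζ' : TZ (EM := EM) z) : Prop :=
  ∃ u : Q, dπ z ζ = ρ z.1 (e.symmₗ ℝ z.1 u) ∧ dπ z ζ' = ρ z.1 (e.symmₗ ℝ z.1 (imQ z.2 • u)) ∧
    vertComp P nabla e z ζ' = imQ z.2 * vertComp P nabla e z ζ

/-- The curvature form, in a trivialization, composed with `ρ`. -/
def frameCurv [IsManifold 𝓘(ℝ, EM) 1 M] (x : M) (u v w : Q) : Q :=
  let X : ∀ y : M, TangentSpace 𝓘(ℝ, EM) y := FiberBundle.extend EM (ρ x (e.symmₗ ℝ x u))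
  let Y : ∀ y : M, TangentSpace 𝓘(ℝ, EM) y := FiberBundle.extend EM (ρ x (e.symmₗ ℝ x v))
  let s : ∀ y : M, V y := FiberBundle.extend Q (e.symmₗ ℝ x w)
  e.linearMapAt ℝ x (nabla (fun y => nabla s y (Y y)) x (X x)
    - nabla (fun y => nabla s y (X y)) x (Y x)
    - nabla s x (VectorField.mlieBracket 𝓘(ℝ, EM) X Y x))

variable {P ρ nabla e} [IsBoundedSMul ℍ[ℝ] Q] [IsScalarTower ℝ ℍ[ℝ] Q]
  [IsManifold 𝓘(ℝ, EM) ∞ M] [ContMDiffVectorBundle ∞ Q V 𝓘(ℝ, EM)]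
  [FiniteDimensional ℝ EM] [T2Space M] [nabla.ContMDiffCovariantDerivative ∞]

/-- The commutator with an imaginary unit of the `ℍ`-component of the curvature form. -/
lemma curvPart_commutator_eq {x : M} (hx : x ∈ e.baseSet) {a : ℍ[ℝ]} (ha : a * a = -1)
    (hQ : ∀ m : Q → Q → ℍ[ℝ], (∀ u v, m u v * a = -(a * m u v)) →
      (∀ u v w, m u v • w + m v w • u + m w u • v = 0) → ∀ u v, m u v = 0)
    (hB : ∀ u v w, let C := frameCurv ρ nabla e x
      ((C u v w - C (a • u) (a • v) w) - (C u (a • v) (a • w) + C (a • u) v (a • w))) +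
      ((C v w u - C (a • v) (a • w) u) - (C v (a • w) (a • u) + C (a • v) w (a • u))) +
      ((C w u v - C (a • w) (a • u) v) - (C w (a • u) (a • v) + C (a • w) u (a • v))) = 0)
    (hB' : ∀ u v w, let C := frameCurv ρ nabla e x
      ((C u v (a • w) - C (a • u) (a • v) (a • w)) + (C u (a • v) w + C (a • u) v w)) +
      ((C v w (a • u) - C (a • v) (a • w) (a • u)) + (C v (a • w) u + C (a • v) w u)) +
      ((C w u (a • v) - C (a • w) (a • u) (a • v)) + (C w (a • u) v + C (a • w) u v)) = 0)
    {Γ : M → EM →L[ℝ] Q →L[ℝ] Q} (hΓ' : MDifferentiableAt 𝓘(ℝ, EM) 𝓘(ℝ, EM →L[ℝ] Q →L[ℝ] Q) Γ x)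
    {φ : M → EM} (hφ : ContMDiffAt 𝓘(ℝ, EM) 𝓘(ℝ, EM) ∞ φ x)
    (hΓ : ∀ᶠ y in 𝓝 x, ∀ (X : TangentSpace 𝓘(ℝ, EM) y) (q : Q),
      frameForm nabla e y X q = Γ y (mvfderiv 𝓘(ℝ, EM) φ y X) q)
    (hc : ∀ᶠ y in 𝓝 x, ∀ v, IsQuaternionicEnd P (Γ y v)) (u v : Q) :
    let c := fun u v : Q => curvPart 𝓘(ℝ, EM) φ Γ P x (ρ x (e.symmₗ ℝ x u)) (ρ x (e.symmₗ ℝ x v))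
    a * ((c u v - c (a • u) (a • v)) * a - a * (c u v - c (a • u) (a • v))) =
      (c u (a • v) + c (a • u) v) * a - a * (c u (a • v) + c (a • u) v) := by
  intro c
  have hS := fun u v : Q => curvPart_spec (φ := φ) hΓ' hc (ρ x (e.symmₗ ℝ x u))
    (ρ x (e.symmₗ ℝ x v))
  choose S hSc hS using hS
  -- The curvature splits into left multiplication by its component and an `ℍ`-linear part; the
  -- extensions used to define it are smooth near `x`, so the local formula applies.
  have hC (u v w : Q) : frameCurv ρ nabla e x u v w = c u v • w + S u v w := by
    rw [← hS u v w]
    obtain ⟨U, hU, hs⟩ := FiberBundle.exists_contMDiffOn_extend 𝓘(ℝ, EM) Q (k := ∞)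
      (e.symmₗ ℝ x w)
    obtain ⟨U', hU', hUo, hxU⟩ := mem_nhds_iff.1 hU
    have hX (v : Q) := FiberBundle.contMDiffAt_extend 𝓘(ℝ, EM) EM (k := ∞) (ρ x (e.symmₗ ℝ x v))
    have h1 := linearMapAt_curvatureOfFields hx hφ hΓ' hΓ hUo hxU (hs.mono hU')
      ((hX u).mdifferentiableAt (by simp)) ((hX v).mdifferentiableAt (by simp))
    simp only [FiberBundle.extend_apply_self, e.linearMapAt_symmₗ hx] at h1
    rw [← h1]
    simp only [frameCurv, FiberBundle.extend_apply_self]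
  simp only [hC] at hB hB'
  refine commutator_eq_of_bianchi (r := fun u v => c u v - c (a • u) (a • v))
    (r' := fun u v => c u (a • v) + c (a • u) v)
    (S := fun u v w => S u v w - S (a • u) (a • v) w)
    (S' := fun u v w => S u (a • v) w + S (a • u) v w) ha hQ ?_ ?_ ?_ ?_ u v
  · intro u v c q; simp only [hSc, smul_sub]
  · intro u v c q; simp only [hSc, smul_add]
  · intro u v w
    rw [← hB u v w]
    simp only [sub_smul, add_smul]
    abel
  · intro u v w
    rw [← hB' u v w]
    simp only [sub_smul, add_smul]
    abel

/-- The distribution `𝒞` is closed under brackets. -/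
lemma isInFrameC_mlieBracket {z : M × S2} (hx : z.1 ∈ e.baseSet)
    (hρ : ContMDiff (𝓘(ℝ, EM).prod 𝓘(ℝ, Q)) (𝓘(ℝ, EM).prod 𝓘(ℝ, EM)) ∞
      (fun v : TotalSpace Q V => (⟨v.1, ρ v.1 v.2⟩ : TangentBundle 𝓘(ℝ, EM) M)))
    (hcompat : ∀ y ∈ e.baseSet, ∀ X, IsQuaternionicEnd P (interpolate (frameForm nabla e y X)))
    (ht : ∀ q q', ρ z.1 (nabla (fun y => e.symmₗ ℝ y q') z.1 (ρ z.1 (e.symmₗ ℝ z.1 q))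
        - nabla (fun y => e.symmₗ ℝ y q) z.1 (ρ z.1 (e.symmₗ ℝ z.1 q')))
        - VectorField.mlieBracket 𝓘(ℝ, EM) (fun y => ρ y (e.symmₗ ℝ y q))
          (fun y => ρ y (e.symmₗ ℝ y q')) z.1 = 0)
    (hker : ∀ q, ρ z.1 (e.symmₗ ℝ z.1 q) = 0 → ρ z.1 (e.symmₗ ℝ z.1 (imQ z.2 • q)) = 0 → q = 0)
    (hQ : ∀ m : Q → Q → ℍ[ℝ], (∀ u v, m u v * imQ z.2 = -(imQ z.2 * m u v)) →
      (∀ u v w, m u v • w + m v w • u + m w u • v = 0) → ∀ u v, m u v = 0)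
    (hB : ∀ u v w, let C := frameCurv ρ nabla e z.1; let a := imQ z.2
      ((C u v w - C (a • u) (a • v) w) - (C u (a • v) (a • w) + C (a • u) v (a • w))) +
      ((C v w u - C (a • v) (a • w) u) - (C v (a • w) (a • u) + C (a • v) w (a • u))) +
      ((C w u v - C (a • w) (a • u) v) - (C w (a • u) (a • v) + C (a • w) u (a • v))) = 0)
    (hB' : ∀ u v w, let C := frameCurv ρ nabla e z.1; let a := imQ z.2
      ((C u v (a • w) - C (a • u) (a • v) (a • w)) + (C u (a • v) w + C (a • u) v w)) +
      ((C v w (a • u) - C (a • v) (a • w) (a • u)) + (C v (a • w) u + C (a • v) w u)) +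
      ((C w u (a • v) - C (a • w) (a • u) (a • v)) + (C w (a • u) v + C (a • w) u v)) = 0)
    {X X' Y Y' : ∀ y : M × S2, TZ (EM := EM) y}
    (hX : MDifferentiableAt (𝓘(ℝ, EM).prod (𝓡 2)) (𝓘(ℝ, EM).prod (𝓡 2)).tangent
      (fun y => (⟨y, X y⟩ : TangentBundle (𝓘(ℝ, EM).prod (𝓡 2)) (M × S2))) z)
    (hX' : MDifferentiableAt (𝓘(ℝ, EM).prod (𝓡 2)) (𝓘(ℝ, EM).prod (𝓡 2)).tangent
      (fun y => (⟨y, X' y⟩ : TangentBundle (𝓘(ℝ, EM).prod (𝓡 2)) (M × S2))) z)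
    (hY : MDifferentiableAt (𝓘(ℝ, EM).prod (𝓡 2)) (𝓘(ℝ, EM).prod (𝓡 2)).tangent
      (fun y => (⟨y, Y y⟩ : TangentBundle (𝓘(ℝ, EM).prod (𝓡 2)) (M × S2))) z)
    (hY' : MDifferentiableAt (𝓘(ℝ, EM).prod (𝓡 2)) (𝓘(ℝ, EM).prod (𝓡 2)).tangent
      (fun y => (⟨y, Y' y⟩ : TangentBundle (𝓘(ℝ, EM).prod (𝓡 2)) (M × S2))) z)
    (hXC : ∀ᶠ y in 𝓝 z, IsInFrameC P ρ nabla e y (X y) (X' y))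
    (hYC : ∀ᶠ y in 𝓝 z, IsInFrameC P ρ nabla e y (Y y) (Y' y)) :
    IsInFrameC P ρ nabla e z
      (VectorField.mlieBracket (𝓘(ℝ, EM).prod (𝓡 2)) X Y z -
        VectorField.mlieBracket (𝓘(ℝ, EM).prod (𝓡 2)) X' Y' z)
      (VectorField.mlieBracket (𝓘(ℝ, EM).prod (𝓡 2)) X Y' z +
        VectorField.mlieBracket (𝓘(ℝ, EM).prod (𝓡 2)) X' Y z) := by
  let I := 𝓘(ℝ, EM).prod (𝓡 2)
  have hcs := chart_source_mem_nhds EM z.1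
  let φ := extChartAt 𝓘(ℝ, EM) z.1
  have hφ {y : M} (hy : y ∈ (chartAt EM z.1).source) :
      ContMDiffAt 𝓘(ℝ, EM) 𝓘(ℝ, EM) ∞ φ y := contMDiffAt_extChartAt' hy
  have hφz := hφ (mem_chart_source EM z.1)
  obtain ⟨Γ, hΓd, hΓ⟩ := exists_connectionForm (nabla := nabla) hx
  have hqe : ∀ᶠ y in 𝓝 z.1, ∀ v, IsQuaternionicEnd P (Γ y v) := by
    filter_upwards [hΓ, hcs, e.open_baseSet.mem_nhds hx] with y hy hyc hye v
    obtain ⟨X, rfl⟩ := (mvfderiv_extChartAt_bijective hyc).2 v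
    have h1 : interpolate (frameForm nabla e y X) =
        Γ y (mvfderiv 𝓘(ℝ, EM) (extChartAt 𝓘(ℝ, EM) z.1) y X) := by
      ext q
      rw [show frameForm nabla e y X = _ from funext (hy X)]
      exact interpolate_linearMap (Γ y _).toLinearMap q
    rw [← h1]
    exact hcompat y hye X
  have hform : ∀ᶠ y in 𝓝 z.1, ∀ X : TangentSpace 𝓘(ℝ, EM) y,
      P (Γ y (mvfderiv 𝓘(ℝ, EM) φ y X)) = formComp P nabla e y X := by
    filter_upwards [hΓ] with y hy X
    rw [formComp]
    congr 1
    ext q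
    rw [show frameForm nabla e y X = _ from funext (hy X)]
    exact (interpolate_linearMap (Γ y _).toLinearMap q).symm
  have hbase : ∀ᶠ y in 𝓝 z, ∀ ξ : TZ (EM := EM) y, mvfderiv I (fun z : M × S2 => φ z.1) y ξ =
      mvfderiv 𝓘(ℝ, EM) φ y.1 (dπ y ξ) := by
    filter_upwards [continuousAt_fst.preimage_mem_nhds hcs] with y hy ξ
    exact mvfderiv_comp_fst ((hφ hy).mdifferentiableAt (by simp)) ξ
  have hvert : ∀ᶠ y in 𝓝 z, ∀ ξ : TZ (EM := EM) y,
      vertPart I (fun z : M × S2 => φ z.1) (fun z => imQ z.2) (fun z => Γ z.1) P y ξ =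
        vertComp P nabla e y ξ := by
    filter_upwards [hbase, continuousAt_fst.eventually hform] with y hy hyf ξ
    rw [vertPart, formPart, hy, hyf, mvfderiv_imQ_snd, vertComp]
  have hR := mdifferentiableAt_anchorForm hρ hx hφz
  let R := anchorForm ρ e φ
  have hφi := (mvfderiv_extChartAt_bijective (mem_chart_source EM z.1)).1
  have hRz := mdifferentiableAt_comp_fst hR
  have hA := contMDiff_imQ_snd EM M
  have hAd := (hA.contMDiffAt (x := z)).mdifferentiableAt (by simp)
  have hm : IsLocalModelAt I (fun z : M × S2 => φ z.1) (fun z => imQ z.2) (fun z => R z.1)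
      (fun z => Γ z.1) P z := by
    refine ⟨hφz.comp z contMDiffAt_fst, hA.contMDiffAt, hRz, mdifferentiableAt_comp_fst hΓd,
      fun y => imQ_mul_self y.2, hqe.self_of_nhds, fun ξ η q q' hξ hη => ?_⟩
    have hb := hbase.self_of_nhds
    rw [hb] at hξ hη
    have hξ' := hφi (hξ.trans (anchorForm_apply _ _ _))
    have hη' := hφi (hη.trans (anchorForm_apply _ _ _))
    rw [hb, hb, mvfderiv_comp_fst hR, mvfderiv_comp_fst hR, hξ', hη']
    exact anchorForm_connectionForm hρ hx hφz hΓ.self_of_nhds (ht q q')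
  have hsol {X X' : ∀ y : M × S2, TZ (EM := EM) y}
      (hX : MDifferentiableAt I I.tangent (fun y => (⟨y, X y⟩ : TangentBundle I (M × S2))) z)
      (hX' : MDifferentiableAt I I.tangent (fun y => (⟨y, X' y⟩ : TangentBundle I (M × S2))) z)
      (hXC : ∀ᶠ y in 𝓝 z, IsInFrameC P ρ nabla e y (X y) (X' y)) :
      ∃ u : M × S2 → Q, MDifferentiableAt I 𝓘(ℝ, Q) u z ∧
        (∀ᶠ y in 𝓝 z, dπ y (X y) = ρ y.1 (e.symmₗ ℝ y.1 (u y)) ∧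
          dπ y (X' y) = ρ y.1 (e.symmₗ ℝ y.1 (imQ y.2 • u y))) ∧
        (∀ᶠ y in 𝓝 z, mvfderiv I (fun z : M × S2 => φ z.1) y (X y) = R y.1 (u y)) ∧
        (∀ᶠ y in 𝓝 z, mvfderiv I (fun z : M × S2 => φ z.1) y (X' y) = R y.1 (imQ y.2 • u y)) ∧
        ∀ᶠ y in 𝓝 z,
          vertPart I (fun z : M × S2 => φ z.1) (fun z => imQ z.2) (fun z => Γ z.1) P y (X' y) =
          imQ y.2 *
          vertPart I (fun z : M × S2 => φ z.1) (fun z => imQ z.2) (fun z => Γ z.1) P y (X y) := by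
    obtain ⟨u, hu⟩ : ∃ u : M × S2 → Q, ∀ᶠ y in 𝓝 z,
        dπ y (X y) = ρ y.1 (e.symmₗ ℝ y.1 (u y)) ∧
          dπ y (X' y) = ρ y.1 (e.symmₗ ℝ y.1 (imQ y.2 • u y)) ∧
          vertComp P nabla e y (X' y) = imQ y.2 * vertComp P nabla e y (X y) := by
      classical
      -- The vector `u` is chosen point by point, with no regularity; the value `0` only occurs
      -- where `IsInFrameC` fails, away from some neighbourhood of `z`.
      refine ⟨fun y => if h : IsInFrameC P ρ nabla e y (X y) (X' y) then h.choose else 0, ?_⟩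
      filter_upwards [hXC] with y hy
      rw [dif_pos hy]
      exact hy.choose_spec
    have h1 : ∀ᶠ y in 𝓝 z, mvfderiv I (fun z : M × S2 => φ z.1) y (X y) = R y.1 (u y) := by
      filter_upwards [hu, hbase] with y hy hyb
      rw [hyb, hy.1]
      exact (anchorForm_apply _ _ _).symm
    have h2 : ∀ᶠ y in 𝓝 z, mvfderiv I (fun z : M × S2 => φ z.1) y (X' y) =
        R y.1 (imQ y.2 • u y) := by
      filter_upwards [hu, hbase] with y hy hyb
      rw [hyb, hy.2.1]
      exact (anchorForm_apply _ _ _).symm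
    refine ⟨u, ?_, hu.mono fun y hy => ⟨hy.1, hy.2.1⟩, h1, h2, ?_⟩
    -- Near `z`, `u` solves the system `(R u, R (a u)) = (dφ X, dφ X')`. It is injective at `z` by
    -- the kernel condition, which forces the chosen `u` to be differentiable there.
    · let T : M × S2 → Q →L[ℝ] EM × EM := fun y =>
        ContinuousLinearMap.inl ℝ EM EM ∘L R y.1 +
          ContinuousLinearMap.inr ℝ EM EM ∘L R y.1 ∘L ContinuousLinearMap.lsmul ℝ ℍ[ℝ] (imQ y.2)
      have hT (y : M × S2) (q : Q) : T y q = (R y.1 q, R y.1 (imQ y.2 • q)) := by simp [T]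
      have hΛ : MDifferentiableAt I 𝓘(ℝ, Q →L[ℝ] Q)
          (fun y : M × S2 => ContinuousLinearMap.lsmul ℝ ℍ[ℝ] (E := Q) (imQ y.2)) z :=
        mdifferentiableAt_clm_comp (ContinuousLinearMap.lsmul ℝ ℍ[ℝ] (E := Q)) hAd
      have hTd : MDifferentiableAt I 𝓘(ℝ, Q →L[ℝ] EM × EM) T z :=
        (mdifferentiableAt_const.clm_comp hRz).add (mdifferentiableAt_const.clm_comp
          (hRz.clm_comp hΛ))
      refine mdifferentiableAt_of_clm_apply_eq hTd
        (g := fun y => (mvfderiv I (fun z : M × S2 => φ z.1) y (X y),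
          mvfderiv I (fun z : M × S2 => φ z.1) y (X' y)))
        ((mdifferentiableAt_mvfderiv_apply hm.contMDiffAt_base hX).prodMk_space
          (mdifferentiableAt_mvfderiv_apply hm.contMDiffAt_base hX')) ?_ ?_
      · refine (injective_iff_map_eq_zero _).2 fun q hq => ?_
        rw [hT, Prod.mk_eq_zero] at hq
        have h0 {q : Q} (hq : R z.1 q = 0) : ρ z.1 (e.symmₗ ℝ z.1 q) = 0 :=
          hφi (((anchorForm_apply _ _ _).symm.trans hq).trans (map_zero _).symm)
        exact hker q (h0 hq.1) (h0 hq.2)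
      · filter_upwards [h1, h2] with y hy hy'
        rw [hT, hy, hy']
    · filter_upwards [hu, hvert] with y hy hyv
      rw [hyv, hyv, hy.2.2]
  obtain ⟨u, hud, huz, hu, hu', huv⟩ := hsol hX hX' hXC
  obtain ⟨v, hvd, hvz, hv, hv', hvv⟩ := hsol hY hY' hYC
  obtain ⟨w, hw, hw'⟩ := hm.exists_mvfderiv_base_bracket_eq hX hX' hY hY' hud hvd hu hu' hv hv'
    huv.self_of_nhds hvv.self_of_nhds
  refine ⟨w, ?_, ?_, ?_⟩
  · rw [hbase.self_of_nhds] at hw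
    exact hφi (hw.trans (anchorForm_apply _ _ _))
  · rw [hbase.self_of_nhds] at hw'
    exact hφi (hw'.trans (anchorForm_apply _ _ _))
  -- Both `φ` and `Γ` are pulled back from `M`, so the curvature component sees only `dπ ξ` and `dπ
  -- η`.
  · have hcurv (ξ η : TZ (EM := EM) z) :
        curvPart I (fun z : M × S2 => φ z.1) (fun z => Γ z.1) P z ξ η =
          curvPart 𝓘(ℝ, EM) φ Γ P z.1 (dπ z ξ) (dπ z η) := by
      have h1 : ∀ ξ : TZ (EM := EM) z, mvfderiv I (fun z : M × S2 => Γ z.1) z ξ =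
        mvfderiv 𝓘(ℝ, EM) Γ z.1 (dπ z ξ) := mvfderiv_comp_fst hΓd
      simp only [curvPart, formPart, hbase.self_of_nhds, h1]
    have hvt := hvert.self_of_nhds
    rw [← hvt, ← hvt]
    refine hm.vertPart_bracket_eq hX hX' hY hY' huv hvv rfl rfl ?_
    have hcomm := curvPart_commutator_eq hx (imQ_mul_self z.2) hQ hB hB' hΓd hφz hΓ hqe (u z) (v z)
    simp only [hcurv, huz.self_of_nhds.1, huz.self_of_nhds.2, hvz.self_of_nhds.1,
      hvz.self_of_nhds.2]
    exact hcomm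

end Bracket

/-! ### Vertical vectors and the vertical component. -/

section Generic

variable {EM : Type*} [NormedAddCommGroup EM] [NormedSpace ℝ EM]
  {M : Type*} [TopologicalSpace M] [ChartedSpace EM M]
  {F : Type*} [NormedAddCommGroup F] [NormedSpace ℝ F] [FiniteDimensional ℝ F]
  {V : M → Type*} [TopologicalSpace (TotalSpace F V)]
  [∀ x, AddCommGroup (V x)] [∀ x, Module ℝ (V x)] [∀ x, TopologicalSpace (V x)]
  [FiberBundle F V] [VectorBundle ℝ F V]
  [∀ x, IsTopologicalAddGroup (V x)] [∀ x, ContinuousSMul ℝ (V x)]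
  {nabla : CovariantDerivative 𝓘(ℝ, EM) F V}
  {e : Trivialization F (π F V)} [MemTrivializationAtlas e]

lemma interpolate_frameForm [IsManifold 𝓘(ℝ, EM) ∞ M] [ContMDiffVectorBundle ∞ F V 𝓘(ℝ, EM)]
    {x : M} (hx : x ∈ e.baseSet) (X : TangentSpace 𝓘(ℝ, EM) x) (q : F) :
    interpolate (frameForm nabla e x X) q = frameForm nabla e x X q := by
  obtain ⟨D, hD, -⟩ := exists_bilin_frameForm (nabla := nabla) hx
  let B : V x →ₗ[ℝ] V x := { toFun := fun v => D v X, map_add' := by simp, map_smul' := by simp }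
  have h : frameForm nabla e x X = fun q => (e.linearMapAt ℝ x ∘ₗ B ∘ₗ e.symmₗ ℝ x) q :=
    funext fun q => hD q X
  rw [h]
  exact interpolate_linearMap _ q

lemma frameForm_add (x : M) (X Y : TangentSpace 𝓘(ℝ, EM) x) :
    frameForm nabla e x (X + Y) = frameForm nabla e x X + frameForm nabla e x Y := by
  ext1 q
  simp [frameForm]

lemma interpolate_add (f g : F → F) : interpolate (f + g) = interpolate f + interpolate g := by
  simp only [interpolate, Pi.add_apply, map_add, Finset.sum_add_distrib]

variable {P : (F →L[ℝ] F) →L[ℝ] ℍ[ℝ]}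

lemma dS_add (z : M × S2) (ξ η : TZ (EM := EM) z) : dS z (ξ + η) = dS z ξ + dS z η := by
  simp only [← mvfderiv_imQ_snd, map_add]

lemma dπ_add (z : M × S2) (ξ η : TZ (EM := EM) z) : dπ z (ξ + η) = dπ z ξ + dπ z η :=
  map_add _ _ _

lemma vertComp_add (z : M × S2) (ξ η : TZ (EM := EM) z) :
    vertComp P nabla e z (ξ + η) = vertComp P nabla e z ξ + vertComp P nabla e z η := by
  simp only [vertComp, formComp, dS_add, dπ_add, frameForm_add, interpolate_add, map_add]
  noncomm_ring

lemma vertComp_of_dπ_eq_zero {z : M × S2} {ξ : TZ (EM := EM) z} (h : dπ z ξ = 0) :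
    vertComp P nabla e z ξ = dS z ξ := by
  have h1 : formComp P nabla e z.1 0 = 0 := by
    have := frameForm_add (nabla := nabla) (e := e) z.1 0 0
    rw [add_zero, left_eq_add] at this
    simp [formComp, this, interpolate]
  rw [vertComp, h, h1]
  simp

/-- Obtained by differentiating `a² = -1`. -/
lemma dS_mul_imQ (z : M × S2) (ξ : TZ (EM := EM) z) :
    dS z ξ * imQ z.2 = -(imQ z.2 * dS z ξ) := by
  have hA := ((contMDiff_imQ_snd EM M).contMDiffAt (x := z)).mdifferentiableAt (by simp)
  have h1 := mvfderiv_mul_quaternion hA hA ξ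
  simp only [imQ_mul_self, mvfderiv_const, mvfderiv_imQ_snd] at h1
  exact eq_neg_of_add_eq_zero_left h1.symm

/-- A commutator with `a` also anticommutes with `a`. Hence `vertComp` is tangent to the sphere and
is attained by a vertical vector. -/
lemma vertComp_mul_imQ (z : M × S2) (ξ : TZ (EM := EM) z) :
    vertComp P nabla e z ξ * imQ z.2 = -(imQ z.2 * vertComp P nabla e z ξ) := by
  have h (x : ℍ[ℝ]) : x * imQ z.2 * imQ z.2 = -x := by rw [mul_assoc, imQ_mul_self]; simp
  have h' (x : ℍ[ℝ]) : imQ z.2 * (imQ z.2 * x) = -x := by rw [← mul_assoc, imQ_mul_self]; simp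
  simp only [vertComp, add_mul, sub_mul, mul_add, mul_sub, dS_mul_imQ, h, h', mul_assoc (imQ z.2)]
  abel

/-- A quaternion which anticommutes with an imaginary unit is tangent to the sphere. -/
lemma exists_imQ_eq_of_anticommute (a : S2) {n : ℍ[ℝ]} (hn : n * imQ a = -(imQ a * n)) :
    ∃ v ∈ (Submodule.span ℝ {(a : EuclideanSpace ℝ (Fin 3))})ᗮ, imQ v = n := by
  have h : ‖(a : EuclideanSpace ℝ (Fin 3))‖ ^ 2 = 1 := by simp
  rw [EuclideanSpace.norm_sq_eq] at h
  simp only [Real.norm_eq_abs, sq_abs, Fin.sum_univ_three] at h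
  have h0 := congrArg QuaternionAlgebra.re hn
  have h1 := congrArg QuaternionAlgebra.imI hn
  have h2 := congrArg QuaternionAlgebra.imJ hn
  have h3 := congrArg QuaternionAlgebra.imK hn
  simp at h0 h1 h2 h3
  refine ⟨!₂[n.imI, n.imJ, n.imK], ?_, ?_⟩
  · rw [Submodule.mem_orthogonal_singleton_iff_inner_right]
    simp [PiLp.inner_apply, Fin.sum_univ_three]
    linarith
  · ext
    · simp
      -- Anticommutation gives `2 (Re n) a = 0` in the imaginary part; pairing with `a` yields `Re n
      -- = 0`.
      linear_combination n.re * h + (-a.1 0 / 2) * h1 + (-a.1 1 / 2) * h2 + (-a.1 2 / 2) * h3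
    all_goals simp

/-- The vertical vectors tangent to `M × S2`. -/
lemma exists_vertical (z : M × S2) {n : ℍ[ℝ]} (hn : n * imQ z.2 = -(imQ z.2 * n)) :
    ∃ ξ : TZ (EM := EM) z, dπ z ξ = 0 ∧ dS z ξ = n := by
  obtain ⟨v, hv, rfl⟩ := exists_imQ_eq_of_anticommute z.2 hn
  rw [← range_mvfderiv_subtypeVal (n := 2)] at hv
  obtain ⟨τ, rfl⟩ := hv
  refine ⟨(0, τ), ?_, ?_⟩
  · exact congrArg (fun L => L ((0, τ) : TZ (EM := EM) z))
      (mfderiv_fst (I := 𝓘(ℝ, EM)) (I' := 𝓡 2) (x := z))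
  · have h1 := mfderiv_comp (I := 𝓘(ℝ, EM).prod (𝓡 2)) (I' := 𝓡 2)
      (I'' := 𝓘(ℝ, EuclideanSpace ℝ (Fin 3))) z
      (g := fun a : S2 => (a : EuclideanSpace ℝ (Fin 3))) (f := (Prod.snd : M × S2 → S2))
      (((contMDiff_coe_sphere (E := EuclideanSpace ℝ (Fin 3)) (n := 2) (m := ∞)) z.2
        ).mdifferentiableAt (by simp)) mdifferentiableAt_snd
    rw [mfderiv_snd] at h1
    exact congrArg imQ (congrArg (fun L => L ((0, τ) : TZ (EM := EM) z)) h1)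

end Generic

/-! ### Translation of the original definitions into the trivialization. -/

section Concrete

variable {EM : Type*} [NormedAddCommGroup EM] [NormedSpace ℝ EM]
  {M : Type*} [TopologicalSpace M] [ChartedSpace EM M] {k : ℕ} [NeZero k]
  {V : M → Type*} [TopologicalSpace (TotalSpace (QSpace k) V)]
  [∀ x, AddCommGroup (V x)] [∀ x, Module ℝ (V x)] [∀ x, TopologicalSpace (V x)]
  [FiberBundle (QSpace k) V] [VectorBundle ℝ (QSpace k) V]
  {e : Trivialization (QSpace k) (π (QSpace k) V)} [MemTrivializationAtlas e]
  {ρ : ∀ x : M, V x →ₗ[ℝ] TangentSpace 𝓘(ℝ, EM) x}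

omit [NeZero k] in
lemma trivJ_symmₗ {x : M} (hx : x ∈ e.baseSet) (a : S2) (q : QSpace k) :
    trivJ e x a (e.symmₗ ℝ x q) = e.symmₗ ℝ x (imQ a • q) := by
  simp [trivJ, e.linearMapAt_symmₗ hx, leftMul_apply]

omit [NeZero k] in
lemma mem_kerAddI_trivJ_iff {x : M} (hx : x ∈ e.baseSet) (a : S2) (w : V x × V x) :
    w ∈ kerAddI (trivJ e x a) ↔
      ∃ u : QSpace k, w.1 = e.symmₗ ℝ x u ∧ w.2 = e.symmₗ ℝ x (imQ a • u) := by
  constructor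
  · rintro ⟨h, -⟩
    refine ⟨e.linearMapAt ℝ x w.1, (e.symmₗ_linearMapAt hx _).symm, ?_⟩
    rw [← trivJ_symmₗ hx, e.symmₗ_linearMapAt hx]
    exact (sub_eq_zero.1 h).symm
  · rintro ⟨u, h1, h2⟩
    refine ⟨?_, ?_⟩
    · rw [h1, h2, trivJ_symmₗ hx, sub_self]
    · rw [h1, h2, trivJ_symmₗ hx, imQ_smul_imQ_smul, map_neg, neg_add_cancel]

-- The subspace `ker ρ ∩ ker (ρ ∘ J)` is preserved by `J`, because `J² = -1`, so the kernel
-- hypothesis makes it zero.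
omit [NeZero k] in
lemma eq_zero_of_mem_ker_anchor {x : M} (hx : x ∈ e.baseSet) (a : S2)
    (hker : ∀ J ∈ admissible k V x, ∀ W : Submodule ℝ (V x),
      W ≤ LinearMap.ker (ρ x) → (∀ w ∈ W, J w ∈ W) → W = ⊥)
    {q : QSpace k} (h1 : ρ x (e.symmₗ ℝ x q) = 0) (h2 : ρ x (e.symmₗ ℝ x (imQ a • q)) = 0) :
    q = 0 := by
  have hW := hker (trivJ e x a) ⟨e, inferInstance, hx, a, rfl⟩
    (LinearMap.ker (ρ x) ⊓ LinearMap.ker (ρ x ∘ₗ trivJ e x a)) inf_le_left ?_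
  · have h3 : e.symmₗ ℝ x q ∈ LinearMap.ker (ρ x) ⊓ LinearMap.ker (ρ x ∘ₗ trivJ e x a) := by
      refine ⟨h1, ?_⟩
      change ρ x (trivJ e x a (e.symmₗ ℝ x q)) = 0
      rw [trivJ_symmₗ hx, h2]
    rw [hW, Submodule.mem_bot] at h3
    rw [← e.linearMapAt_symmₗ (R := ℝ) hx q, h3, map_zero]
  · rintro w ⟨hw1, hw2⟩
    refine ⟨hw2, ?_⟩
    have h3 : trivJ e x a (trivJ e x a w) = -w := by
      rw [← e.symmₗ_linearMapAt (R := ℝ) hx w, trivJ_symmₗ hx, trivJ_symmₗ hx, imQ_smul_imQ_smul, map_neg]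
    change ρ x (trivJ e x a (trivJ e x a w)) = 0
    rw [h3, map_neg, LinearMap.mem_ker.1 hw1, neg_zero]

variable [∀ x, IsTopologicalAddGroup (V x)] [∀ x, ContinuousSMul ℝ (V x)]
  {nabla : CovariantDerivative 𝓘(ℝ, EM) (QSpace k) V}
  [IsManifold 𝓘(ℝ, EM) ∞ M] [ContMDiffVectorBundle ∞ (QSpace k) V 𝓘(ℝ, EM)]

lemma isQuaternionicEnd_frameForm (hcompat : IsCompatible nabla) {x : M} (hx : x ∈ e.baseSet)
    (X : TangentSpace 𝓘(ℝ, EM) x) :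
    IsQuaternionicEnd leftPart (interpolate (frameForm nabla e x X)) := by
  obtain ⟨p, B, h⟩ := hcompat e x hx X
  exact leftPart_spec ⟨p, B, fun q => (interpolate_frameForm hx X q).trans (h q)⟩

/-- By compatibility the defining expression is left multiplication of `q` by `vertComp`; the vector
with all entries `1` detects it, as `k ≠ 0`. -/
lemma isHorizontal_iff (hcompat : IsCompatible nabla) {z : M × S2} (hx : z.1 ∈ e.baseSet)
    (ξ : TZ (EM := EM) z) :
    IsHorizontal nabla e z ξ ↔ vertComp leftPart nabla e z ξ = 0 := by
  have h (q : QSpace k) : leftMul k (dS z ξ) q + connForm nabla e z.1 (dπ z ξ)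
      (leftMul k (imQ z.2) q) - leftMul k (imQ z.2) (connForm nabla e z.1 (dπ z ξ) q) =
      vertComp leftPart nabla e z ξ • q := by
    have h1 := isQuaternionicEnd_frameForm hcompat hx (dπ z ξ) (imQ z.2) q
    rw [interpolate_frameForm hx, interpolate_frameForm hx, sub_eq_iff_eq_add] at h1
    change dS z ξ • q + frameForm nabla e z.1 (dπ z ξ) (imQ z.2 • q) -
      imQ z.2 • frameForm nabla e z.1 (dπ z ξ) q = _
    rw [h1, vertComp, formComp]
    simp only [add_smul, sub_smul, smul_sub, mul_smul]
    abel
  simp only [IsHorizontal, h]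
  refine ⟨fun h0 => ?_, fun h0 q => by rw [h0, zero_smul]⟩
  simpa using congrFun (h0 fun _ => 1) 0

lemma mem_distC_iff (hcompat : IsCompatible nabla) {z : M × S2} (hx : z.1 ∈ e.baseSet)
    (ζ ζ' : TZ (EM := EM) z) :
    (ζ, ζ') ∈ distC nabla ρ e z ↔ IsInFrameC leftPart ρ nabla e z ζ ζ' := by
  constructor
  · rintro ⟨v, ⟨hv1, hv2, hv3, -⟩, b, ⟨hb1, hb2, w, hw, hbw1, hbw2⟩, h⟩
    obtain ⟨rfl, rfl⟩ := Prod.mk.inj h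
    obtain ⟨u, hu1, hu2⟩ := (mem_kerAddI_trivJ_iff hx z.2 w).1 hw
    rw [isHorizontal_iff hcompat hx] at hb1 hb2
    refine ⟨u, ?_, ?_, ?_⟩
    · rw [dπ_add, hv1, zero_add, hbw1, hu1]
    · rw [dπ_add, hv2, zero_add, hbw2, hu2]
    · rw [vertComp_add, vertComp_add, hb1, hb2, vertComp_of_dπ_eq_zero hv1,
        vertComp_of_dπ_eq_zero hv2, add_zero, add_zero]
      exact (sub_eq_zero.1 hv3).symm
  · rintro ⟨u, h1, h2, h3⟩
    -- The splitting is forced: `v` and `w` are the vertical vectors with the same vertical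
    -- components as `ζ` and `ζ'`, and the differences are horizontal.
    obtain ⟨v, hv, hv'⟩ := exists_vertical (EM := EM) z
      (vertComp_mul_imQ (P := leftPart) (nabla := nabla) (e := e) z ζ)
    obtain ⟨w, hw, hw'⟩ := exists_vertical (EM := EM) z
      (vertComp_mul_imQ (P := leftPart) (nabla := nabla) (e := e) z ζ')
    have hsub {ξ η : TZ (EM := EM) z} (hη : dπ z η = 0)
        (h : dS z η = vertComp leftPart nabla e z ξ) :
        IsHorizontal nabla e z (ξ - η) ∧ dπ z (ξ - η) = dπ z ξ := by
      have h1 := vertComp_add (P := leftPart) (nabla := nabla) (e := e) z (ξ - η) η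
      have h2 := dπ_add z (ξ - η) η
      rw [sub_add_cancel] at h1 h2
      rw [vertComp_of_dπ_eq_zero hη, h, right_eq_add] at h1
      rw [hη, add_zero] at h2
      exact ⟨(isHorizontal_iff hcompat hx _).2 h1, h2.symm⟩
    refine ⟨(v, w), ⟨hv, hw, ?_, ?_⟩, (ζ - v, ζ' - w), ⟨(hsub hv hv').1, (hsub hw hw').1,
      (e.symmₗ ℝ z.1 u, e.symmₗ ℝ z.1 (imQ z.2 • u)),
      (mem_kerAddI_trivJ_iff hx z.2 _).2 ⟨u, rfl, rfl⟩, (hsub hv hv').2.trans h1,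
      (hsub hw hw').2.trans h2⟩, ?_⟩
    · change imQ z.2 * dS z v - dS z w = 0
      rw [hv', hw', h3, sub_self]
    · change imQ z.2 * dS z w + dS z v = 0
      rw [hv', hw', h3, ← mul_assoc, imQ_mul_self]
      simp
    · rw [Prod.mk_add_mk, add_sub_cancel, add_sub_cancel]

omit [NeZero k] in
/-- The first Bianchi identity in a trivialization. -/
lemma frameCurv_bianchi (h : SatisfiesFirstBianchi nabla ρ) {x : M} (hx : x ∈ e.baseSet) (a : S2)
    (u v w : QSpace k) :
    let C := frameCurv ρ nabla e x
    let a := imQ a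
    ((C u v w - C (a • u) (a • v) w) - (C u (a • v) (a • w) + C (a • u) v (a • w))) +
      ((C v w u - C (a • v) (a • w) u) - (C v (a • w) (a • u) + C (a • v) w (a • u))) +
      ((C w u v - C (a • w) (a • u) v) - (C w (a • u) (a • v) + C (a • w) u (a • v))) = 0 ∧
    ((C u v (a • w) - C (a • u) (a • v) (a • w)) + (C u (a • v) w + C (a • u) v w)) +
      ((C v w (a • u) - C (a • v) (a • w) (a • u)) + (C v (a • w) u + C (a • v) w u)) +
      ((C w u (a • v) - C (a • w) (a • u) (a • v)) + (C w (a • u) v + C (a • w) u v)) = 0 := by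
  intro C a'
  have hk (q : QSpace k) : (e.symmₗ ℝ x q, e.symmₗ ℝ x (a' • q)) ∈ kerAddI (trivJ e x a) :=
    (mem_kerAddI_trivJ_iff hx a _).2 ⟨q, rfl, rfl⟩
  have hb := h.bianchi x (trivJ e x a) ⟨e, inferInstance, hx, a, rfl⟩ _ (hk u) _ (hk v) _ (hk w)
  -- The two identities are the real and imaginary parts of the complex one, evaluated on `q + i a
  -- q` for `q = u, v, w`.
  have h1 := congrArg (fun p => e.linearMapAt ℝ x p.1) hb
  have h2 := congrArg (fun p => e.linearMapAt ℝ x p.2) hb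
  simp only [curvatureRhoC, complexify₂, Prod.fst_add, Prod.snd_add, Prod.fst_zero, Prod.snd_zero,
    map_add, map_sub, map_zero, Pi.sub_apply, Pi.add_apply] at h1 h2
  exact ⟨h1, h2⟩

end Concrete

end CoCR

end

theorem corollary2p3
    {EM : Type*} [NormedAddCommGroup EM] [NormedSpace ℝ EM] [FiniteDimensional ℝ EM]
    {M : Type*} [TopologicalSpace M] [T2Space M] [ChartedSpace EM M] [IsManifold 𝓘(ℝ, EM) ∞ M]
    {k : ℕ} {V : M → Type*} [TopologicalSpace (TotalSpace (CoCR.QSpace k) V)]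
    [∀ x, AddCommGroup (V x)] [∀ x, Module ℝ (V x)] [∀ x, TopologicalSpace (V x)]
    [∀ x, IsTopologicalAddGroup (V x)] [∀ x, ContinuousSMul ℝ (V x)]
    [FiberBundle (CoCR.QSpace k) V] [VectorBundle ℝ (CoCR.QSpace k) V]
    [ContMDiffVectorBundle ∞ (CoCR.QSpace k) V 𝓘(ℝ, EM)]
    (ρ : ∀ x : M, V x →ₗ[ℝ] TangentSpace 𝓘(ℝ, EM) x)
    (hρ : CoCR.IsAlmostCoCRQuaternionic k ρ)
    (hrank : 4 < Module.finrank ℝ (CoCR.QSpace k))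
    (nabla : CovariantDerivative 𝓘(ℝ, EM) (CoCR.QSpace k) V)
    [nabla.ContMDiffCovariantDerivative ∞]
    (hcompat : CoCR.IsCompatible nabla)
    (hbianchi : CoCR.SatisfiesFirstBianchi nabla ρ) :
    CoCR.IsIntegrable nabla ρ := by
  -- The rank condition excludes `k = 0`, as required by `leftPart`, which reads off the coordinate
  -- with index `0`.
  have : NeZero k := ⟨fun h => by
    subst h
    rw [Module.finrank_zero_of_subsingleton] at hrank
    omega⟩
  intro e _ O hO hOe X Y hX hY z hz
  have hx {y : M × CoCR.S2} (hy : y ∈ O) : y.1 ∈ e.baseSet := (hOe hy).1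
  have hd {X : ∀ z : M × CoCR.S2, CoCR.TZ (EM := EM) z} (hX : CoCR.IsSmoothFieldOn X O) :
      MDifferentiableAt (𝓘(ℝ, EM).prod (𝓡 2)) (𝓘(ℝ, EM).prod (𝓡 2)).tangent
        (fun y => (⟨y, X y⟩ : TangentBundle (𝓘(ℝ, EM).prod (𝓡 2)) (M × CoCR.S2))) z :=
    ((hX z hz).contMDiffAt (hO.mem_nhds hz)).mdifferentiableAt (by simp)
  have hC {X} (hX : CoCR.IsSectionOfC nabla ρ e O X) :
      ∀ᶠ y in 𝓝 z, CoCR.IsInFrameC CoCR.leftPart ρ nabla e y (X.1 y) (X.2 y) := by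
    filter_upwards [hO.mem_nhds hz] with y hy
    exact (CoCR.mem_distC_iff hcompat (hx hy) _ _).1 (hX.2.2 y hy)
  refine (CoCR.mem_distC_iff hcompat (hx hz) _ _).2 ?_
  exact CoCR.isInFrameC_mlieBracket (hx hz) hρ.smooth
    (fun y hy X => CoCR.isQuaternionicEnd_frameForm hcompat hy X)
    -- Absence of torsion is used only on sections with constant coordinates over the base set of
    -- `e`.
    (fun q q' => hbianchi.torsionFree e.baseSet _ _ e.open_baseSet
      (fun y hy => (CoCR.contMDiffAt_symm_const hy q).contMDiffWithinAt)
      (fun y hy => (CoCR.contMDiffAt_symm_const hy q').contMDiffWithinAt) z.1 (hx hz))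
    (fun q h1 h2 => CoCR.eq_zero_of_mem_ker_anchor (hx hz) z.2 (hρ.kernel z.1) h1 h2)
    (CoCR.eq_zero_of_cyclic_sum_eq_zero hrank z.2)
    (fun u v w => (CoCR.frameCurv_bianchi hbianchi (hx hz) z.2 u v w).1)
    (fun u v w => (CoCR.frameCurv_bianchi hbianchi (hx hz) z.2 u v w).2)
    (hd hX.1) (hd hX.2.1) (hd hY.1) (hd hY.2.1) (hC hX) (hC hY)
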